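/- Let $p$ be an odd prime and let $G = Q(16,p,1) = C_p \rtimes Q_{16}$, where $Q_{16} = \langle x, y \mid x^4 = y^2,\ yxy^{-1} = x^{-1}\rangle$ is the generalised quaternion group of order $16$, $C_p = \langle z \mid z^p = 1\rangle$, and $xzx^{-1} = z^{-1}$, $yzy^{-1} = z$. Then $|G| = 16p$ and $H^4(G;\mathbb{Z}) \cong \mathbb{Z}/16p$, where $G$ acts trivially on $\mathbb{Z}$. Let $\psi_4 \colon \mathrm{Aut}(G) \to (\mathbb{Z}/16p)^\times$ be the homomorphism that sends $\theta$ to the unit corresponding to the induced automorphism $\theta^*$ of $H^4(G;\mathbb{Z})$ under the identifications $\mathrm{Aut}(H^4(G;\mathbb{Z})) \cong \mathrm{Aut}(\mathbb{Z}/16p) \cong (\mathbb{Z}/16p)^\times$ (for any choice of isomorphism $H^4(G;\mathbb{Z}) \cong \mathbb{Z}/16p$). Then $$\mathrm{Im}(\psi_4) = ((\mathbb{Z}/16p)^\times)^2,$$ the subgroup of squares. -/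

import Mathlib

/-- The homomorphism `Q₁₆ → {±1}` with `x ↦ -1` and `y ↦ 1`. Here `Q₁₆` is `QuaternionGroup 4`,
with `x = a 1`, `y = xa 0`, so that `a i = x ^ i` and `xa i = y * x ^ i`. -/
def Q16.sign : QuaternionGroup 4 →* ℤˣ where
  toFun
    | .a i => (-1) ^ i.val
    | .xa i => (-1) ^ i.val
  map_one' := by decide
  map_mul' := by
    rintro (i | i) (j | j) <;> revert i j <;> decide

/-- The action of `{±1}` on an abelian group by `u • z = z ^ u`. -/
def signAction (A : Type*) [CommGroup A] : ℤˣ →* MulAut A where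
  toFun u :=
    { toFun := fun z => z ^ (u : ℤ)
      invFun := fun z => z ^ (u : ℤ)
      left_inv := fun z => by
        change (z ^ (u : ℤ)) ^ (u : ℤ) = z
        rw [← zpow_mul, Int.units_coe_mul_self, zpow_one]
      right_inv := fun z => by
        change (z ^ (u : ℤ)) ^ (u : ℤ) = z
        rw [← zpow_mul, Int.units_coe_mul_self, zpow_one]
      map_mul' := fun z w => mul_zpow z w _ }
  map_one' := by ext z; simp
  map_mul' u v := by
    ext z
    change z ^ ((u * v : ℤˣ) : ℤ) = (z ^ (v : ℤ)) ^ (u : ℤ)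
    rw [← zpow_mul, Units.val_mul, mul_comm]

/-- The group `Q(16, p, 1) = C_p ⋊ Q₁₆`, in which `x z x⁻¹ = z⁻¹` and `y z y⁻¹ = z` for `z ∈ C_p`.
-/
abbrev Q16p (p : ℕ) : Type :=
  Multiplicative (ZMod p) ⋊[(signAction (Multiplicative (ZMod p))).comp Q16.sign] QuaternionGroup 4

/-- The cohomology group `H^k(G; ℤ)`, with trivial action of `G` on `ℤ`. -/
noncomputable abbrev integralCohomology (G : Type) [Group G] (k : ℕ) : ModuleCat ℤ :=
  groupCohomology (Rep.trivial ℤ G ℤ) k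

/-- The map `f^* : H^k(H; ℤ) → H^k(G; ℤ)` induced by a group homomorphism `f : G → H`. -/
noncomputable def cohomologyPullback {G H : Type} [Group G] [Group H] (f : G →* H) (k : ℕ) :
    integralCohomology H k →ₗ[ℤ] integralCohomology G k :=
  (groupCohomology.map (A := Rep.trivial ℤ H ℤ) (B := Rep.trivial ℤ G ℤ) f
    (Rep.ofHom ⟨LinearMap.id, fun _ => rfl⟩) k).hom

theorem cohomologyPullback_id (G : Type) [Group G] (k : ℕ) :
    cohomologyPullback (MonoidHom.id G) k = LinearMap.id :=
  congrArg ModuleCat.Hom.hom (groupCohomology.map_id (B := Rep.trivial ℤ G ℤ) k)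

theorem cohomologyPullback_comp {G H K : Type} [Group G] [Group H] [Group K]
    (f : H →* K) (g : G →* H) (k : ℕ) :
    cohomologyPullback (f.comp g) k = cohomologyPullback g k ∘ₗ cohomologyPullback f k :=
  congrArg ModuleCat.Hom.hom (groupCohomology.map_comp (A := Rep.trivial ℤ K ℤ)
    (B := Rep.trivial ℤ H ℤ) (C := Rep.trivial ℤ G ℤ) f g
    (Rep.ofHom ⟨LinearMap.id, fun _ => rfl⟩) (Rep.ofHom ⟨LinearMap.id, fun _ => rfl⟩) k)

/-- The automorphism `θ^*` of `H^k(G; ℤ)` induced by an automorphism `θ` of `G`. -/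
noncomputable def cohomologyAut {G : Type} [Group G] (k : ℕ) (θ : MulAut G) :
    integralCohomology G k ≃ₗ[ℤ] integralCohomology G k :=
  LinearEquiv.ofLinearMap (cohomologyPullback θ.toMonoidHom k)
    (cohomologyPullback (θ⁻¹ : MulAut G).toMonoidHom k)
    (by
      rw [← cohomologyPullback_comp, ← cohomologyPullback_id]
      congr 1; ext g; exact MulAut.inv_apply_self G θ g)
    (by
      rw [← cohomologyPullback_comp, ← cohomologyPullback_id]
      congr 1; ext g; exact MulAut.apply_inv_self G θ g)

theorem cohomologyAut_mul {G : Type} [Group G] (k : ℕ) (θ η : MulAut G) :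
    cohomologyAut k (θ * η) = (cohomologyAut k θ).trans (cohomologyAut k η) :=
  LinearEquiv.toLinearMap_injective (cohomologyPullback_comp θ.toMonoidHom η.toMonoidHom k)

/-- Given an identification `e : H^k(G; ℤ) ≃ ℤ/n`, the homomorphism `ψ_k : Aut(G) → (ℤ/n)ˣ` which
sends `θ` to the automorphism `θ^*` of `H^k(G; ℤ)`, via `Aut(H^k(G; ℤ)) ≃ Aut(ℤ/n) ≃ (ℤ/n)ˣ`. -/
noncomputable def psi {G : Type} [Group G] {k n : ℕ} (e : integralCohomology G k ≃+ ZMod n) :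
    MulAut G →* (ZMod n)ˣ :=
  MonoidHom.mk'
    (fun θ => (ZMod.AddAutEquivUnits n
      ((e.symm.trans (cohomologyAut k θ).toAddEquiv).trans e)).toMul)
    (fun θ η => by
      rw [mul_comm, ← toMul_add, ← map_add]
      congr 2
      ext c
      simp [cohomologyAut_mul])

/-! Every `θ` in `Aut(G)` preserves `C_p` and induces an automorphism of `Q₁₆ = G/C_p`. So `θ`
raises `z` to some power `a`, and on `Q₁₆` it is, up to conjugation, a power of `x ↦ x³`, `y ↦ y`.
The first contributes `a²` to the action on the `p`-part of `H⁴`, the second a power of `9` to the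
action on the 2-part. Every unit `a` and both classes modulo inner automorphisms occur,
independently. The squares of units mod 16 are exactly `1` and `9`, so by the Chinese remainder
theorem the image is the group of squares mod `16p`.

Both parts of `H⁴` are reached through exact sequences `0 → ℤ → M₃ → M₂ → M₁ → M₀ → ℤ → 0` of
`G`-modules, whose iterated connecting map sends `1 ∈ H⁰(G; ℤ)` to a class `κ ∈ H⁴(G; ℤ)`. One
sequence is the 4-periodic free resolution of `Q₁₆` inflated to `G`; the other is the periodic
resolution of `C_p`, made `G`-equivariant by sign twists. Their terms are not projective over `G`,
but a relative trace shows that their positive-degree cohomology is killed by `m = p`, respectively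
`m = 16` (`TraceEq.smul_eq_cochainD`). Hence `m⁴H⁴ ⊆ ℤκ`. The order of `κ` is the index `d` of the
image of `M₀^G` in `ℤ`, namely `16`, respectively `p`, because `d` is prime to `m`
(`exists_characteristic_class`). The two classes together give `H⁴ ≅ ℤ/16p`.

A `θ`-semilinear endomorphism of such a sequence that is `1` on the right-hand `ℤ` and `r` on the
left-hand one yields `r θ^*κ = κ`, so `ψ₄(θ)` is inverse to `r` modulo `d`. Explicit endomorphisms
have `r = k²` with `ka = 1` in `ℤ/p` (`cyclicExtension_hasDegree`) and `r = 9` for `x ↦ x³`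
(`hasDegree_cube`), while conjugations have `r = 1` (`hasDegree_conj`). -/

open CategoryTheory

/-! ### Inhomogeneous cochains and the relative trace -/

section Cochains

variable {G A B : Type} [Group G] [AddCommGroup A] [AddCommGroup B]

/-- The differential on inhomogeneous cochains. -/
noncomputable def cochainD (ρ : Representation ℤ G A) (n : ℕ) :
    ((Fin n → G) → A) →ₗ[ℤ] ((Fin (n + 1) → G) → A) :=
  (inhomogeneousCochains.d (Rep.of ρ) n).hom

theorem cochainD_apply (ρ : Representation ℤ G A) (n : ℕ) (f : (Fin n → G) → A)
    (g : Fin (n + 1) → G) :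
    cochainD ρ n f g = ρ (g 0) (f fun i => g i.succ) +
      ∑ j : Fin (n + 1), (-1 : ℤ) ^ ((j : ℕ) + 1) • f (Fin.contractNth j (· * ·) g) :=
  inhomogeneousCochains.d_hom_apply (A := Rep.of ρ) n f g

theorem cochainD_cochainD (ρ : Representation ℤ G A) (n : ℕ) (f : (Fin n → G) → A) :
    cochainD ρ (n + 1) (cochainD ρ n f) = 0 :=
  congrArg (fun φ => φ.hom f) (groupCohomology.inhomogeneousCochains.d_comp_d (Rep.of ρ) (n := n))

/-- Pulling back a cochain along a group homomorphism and pushing it along a linear map. -/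
def cochainMap (θ : G →* G) (T : A →ₗ[ℤ] B) (n : ℕ) :
    ((Fin n → G) → A) →ₗ[ℤ] ((Fin n → G) → B) where
  toFun f g := T (f (θ ∘ g))
  map_add' f f' := by ext; simp
  map_smul' c f := by ext; simp

theorem cochainMap_apply (θ : G →* G) (T : A →ₗ[ℤ] B) (n : ℕ) (f : (Fin n → G) → A)
    (g : Fin n → G) : cochainMap θ T n f g = T (f (θ ∘ g)) := rfl

theorem cochainD_cochainMap {ρ : Representation ℤ G A} {τ : Representation ℤ G B}
    {θ : G →* G} {T : A →ₗ[ℤ] B} (hT : ∀ g a, T (ρ (θ g) a) = τ g (T a)) (n : ℕ)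
    (f : (Fin n → G) → A) :
    cochainD τ n (cochainMap θ T n f) = cochainMap θ T (n + 1) (cochainD ρ n f) := by
  ext g
  have h (j : Fin (n + 1)) : θ ∘ Fin.contractNth j (· * ·) g = Fin.contractNth j (· * ·) (θ ∘ g) :=
    Fin.comp_contractNth _ _ (map_mul θ) j g
  simp only [cochainD_apply, cochainMap_apply, map_add, map_sum, map_zsmul, h]
  congr 1
  exact (hT (g 0) _).symm

theorem contractNth_succ_cons {n : ℕ} (j : Fin (n + 1)) (g : G) (w : Fin (n + 1) → G) :
    Fin.contractNth j.succ (· * ·) (Fin.cons g w : Fin (n + 2) → G) =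
      (Fin.cons g (Fin.contractNth j (· * ·) w) : Fin (n + 1) → G) := by
  ext i
  refine Fin.cases ?_ (fun i => ?_) i
  · simp [Fin.contractNth]
  · simp only [Fin.contractNth, Fin.cons_succ, Fin.val_succ, add_lt_add_iff_right, add_left_inj,
      ← Fin.succ_castSucc]

theorem contractNth_zero_cons {n : ℕ} (g : G) (w : Fin (n + 1) → G) :
    Fin.contractNth 0 (· * ·) (Fin.cons g w : Fin (n + 2) → G) =
      (Fin.cons (g * w 0) (fun i => w i.succ) : Fin (n + 1) → G) := by
  ext i
  refine Fin.cases ?_ (fun i => ?_) i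
  · simp [Fin.contractNth]
  · simp [Fin.contractNth]

/-- A relative trace condition which forces `m` to annihilate the cohomology of `ρ` in positive
degrees. -/
def TraceEq [Fintype G] (ρ : Representation ℤ G A) (m : ℤ) : Prop :=
  ∃ h : A →ₗ[ℤ] A, ∀ a, ∑ g, ρ g⁻¹ (h (ρ g a)) = m • a

/-- An averaged contracting homotopy. Put `e(w) = ∑ g⁻¹ h(f(g, w))` and apply `g⁻¹h` to the cocycle
identity at `(g, w)`. Summed over `g`, the leading term `g f(w)` becomes `m f(w)` by the trace
condition, and the others become `-(de)(w)`. The face `(g w₀, …)` supplies the term of `de` on which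
`w₀` acts, after reindexing the sum. -/
theorem TraceEq.smul_eq_cochainD [Fintype G] {ρ : Representation ℤ G A} {m : ℤ}
    (hρ : TraceEq ρ m) {n : ℕ} {f : (Fin (n + 1) → G) → A} (hf : cochainD ρ (n + 1) f = 0) :
    ∃ e, cochainD ρ n e = m • f := by
  obtain ⟨h, hh⟩ := hρ
  refine ⟨fun w => ∑ g, ρ g⁻¹ (h (f (Fin.cons g w))), ?_⟩
  refine funext fun w => ?_
  have key : ∑ g, ρ g⁻¹ (h (cochainD ρ (n + 1) f (Fin.cons g w))) = 0 := by simp [hf]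
  have inner (x : G) : ∑ j : Fin (n + 1 + 1), (-1 : ℤ) ^ ((j : ℕ) + 1) •
      f (Fin.contractNth j (· * ·) (Fin.cons x w)) =
      -(f (Fin.cons (x * w 0) fun i => w i.succ) + ∑ j : Fin (n + 1), (-1 : ℤ) ^ ((j : ℕ) + 1) •
        f (Fin.cons x (Fin.contractNth j (· * ·) w))) := by
    rw [Fin.sum_univ_succ, contractNth_zero_cons, neg_add, ← Finset.sum_neg_distrib]
    congr 1
    · simp
    · refine Finset.sum_congr rfl fun j _ => ?_
      rw [contractNth_succ_cons, Fin.val_succ, pow_succ _ ((j : ℕ) + 1), mul_neg_one, neg_smul]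
  have first : ρ (w 0) (∑ g, ρ g⁻¹ (h (f (Fin.cons g fun i => w i.succ)))) =
      ∑ g, ρ g⁻¹ (h (f (Fin.cons (g * w 0) fun i => w i.succ))) := by
    rw [map_sum, ← Equiv.sum_comp (Equiv.mulRight (w 0))]
    refine Finset.sum_congr rfl fun g _ => ?_
    rw [← Module.End.mul_apply, ← map_mul]
    simp
  simp only [cochainD_apply _ (n + 1), Fin.cons_zero, Fin.cons_succ, inner, map_add, map_neg,
    map_sum, map_zsmul, Finset.sum_add_distrib, Finset.sum_neg_distrib, hh, neg_add] at key
  rw [cochainD_apply, first]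
  rw [Finset.sum_comm] at key
  simp only [← Finset.smul_sum] at key
  rw [← sub_eq_zero, ← neg_eq_zero, ← key]
  simp only [Pi.smul_apply]
  abel

end Cochains

/-! ### Change of coefficients for cochains -/

section Pushforward

variable {G A B C : Type} [Group G] [AddCommGroup A] [AddCommGroup B] [AddCommGroup C]

/-- The map on cochains induced by a map of coefficients. -/
abbrev cochainPush (G : Type) [Group G] {A B : Type} [AddCommGroup A] [AddCommGroup B]
    (T : A →ₗ[ℤ] B) (n : ℕ) : ((Fin n → G) → A) →ₗ[ℤ] ((Fin n → G) → B) :=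
  cochainMap (MonoidHom.id G) T n

theorem cochainPush_exact {S : A →ₗ[ℤ] B} {T : B →ₗ[ℤ] C} (h : Function.Exact S T) {n : ℕ}
    {f : (Fin n → G) → B} (hf : cochainPush G T n f = 0) : ∃ e, cochainPush G S n e = f := by
  have h' (g) : ∃ a, S a = f g := (h (f g)).1 (congrFun hf g)
  choose e he using h'
  exact ⟨e, funext he⟩

theorem cochainPush_cochainPush {S : A →ₗ[ℤ] B} {T : B →ₗ[ℤ] C} (h : Function.Exact S T) (n : ℕ)
    (f : (Fin n → G) → A) : cochainPush G T n (cochainPush G S n f) = 0 :=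
  funext fun g => h.apply_apply_eq_zero (f g)

theorem cochainPush_injective {T : A →ₗ[ℤ] B} (h : Function.Injective T) (n : ℕ) :
    Function.Injective (cochainPush G T n) :=
  fun _ _ hf => funext fun g => h (congrFun hf g)

theorem cochainD_cochainPush {ρ : Representation ℤ G A} {τ : Representation ℤ G B}
    {T : A →ₗ[ℤ] B} (hT : ∀ g a, T (ρ g a) = τ g (T a)) (n : ℕ) (f : (Fin n → G) → A) :
    cochainD τ n (cochainPush G T n f) = cochainPush G T (n + 1) (cochainD ρ n f) :=
  cochainD_cochainMap (θ := MonoidHom.id G) hT n f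

theorem cochainD_zero_eq_zero_iff {ρ : Representation ℤ G A} {f : (Fin 0 → G) → A} :
    cochainD ρ 0 f = 0 ↔ ∀ g, ρ g (f default) = f default := by
  have key (g : Fin 1 → G) : cochainD ρ 0 f g = ρ (g 0) (f default) - f default := by
    rw [cochainD_apply, Subsingleton.elim (fun i : Fin 0 => g i.succ) default]
    simp [Subsingleton.elim (Fin.contractNth 0 (· * ·) g) default, sub_eq_add_neg]
  constructor
  · intro h g
    have := congrFun h fun _ => g
    rw [key] at this
    exact sub_eq_zero.1 this
  · intro h
    funext g
    rw [key, h, sub_self]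
    rfl

end Pushforward

/-! ### Four-term extensions and their iterated connecting map -/

/-- An extension `0 → ℤ → M₃ → M₂ → M₁ → M₀ → ℤ → 0` of representations of `G` over `ℤ`. -/
structure FourExtension {G M₀ M₁ M₂ M₃ : Type} [Group G] [AddCommGroup M₀] [AddCommGroup M₁]
    [AddCommGroup M₂] [AddCommGroup M₃] (ρ₀ : Representation ℤ G M₀) (ρ₁ : Representation ℤ G M₁)
    (ρ₂ : Representation ℤ G M₂) (ρ₃ : Representation ℤ G M₃) where
  ε : M₀ →ₗ[ℤ] ℤ
  d₁ : M₁ →ₗ[ℤ] M₀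
  d₂ : M₂ →ₗ[ℤ] M₁
  d₃ : M₃ →ₗ[ℤ] M₂
  ι : ℤ →ₗ[ℤ] M₃
  ε_equivariant : ∀ g a, ε (ρ₀ g a) = ε a
  d₁_equivariant : ∀ g a, d₁ (ρ₁ g a) = ρ₀ g (d₁ a)
  d₂_equivariant : ∀ g a, d₂ (ρ₂ g a) = ρ₁ g (d₂ a)
  d₃_equivariant : ∀ g a, d₃ (ρ₃ g a) = ρ₂ g (d₃ a)
  ι_equivariant : ∀ g n, ι n = ρ₃ g (ι n)
  ε_surjective : Function.Surjective ε
  exact₀ : Function.Exact d₁ ε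
  exact₁ : Function.Exact d₂ d₁
  exact₂ : Function.Exact d₃ d₂
  exact₃ : Function.Exact ι d₃
  ι_injective : Function.Injective ι

namespace FourExtension

variable {G M₀ M₁ M₂ M₃ : Type} [Group G] [AddCommGroup M₀] [AddCommGroup M₁]
    [AddCommGroup M₂] [AddCommGroup M₃] {ρ₀ : Representation ℤ G M₀} {ρ₁ : Representation ℤ G M₁}
    {ρ₂ : Representation ℤ G M₂} {ρ₃ : Representation ℤ G M₃} (E : FourExtension ρ₀ ρ₁ ρ₂ ρ₃)

/-- `E.Transgresses n k` says that the iterated connecting map of `E` sends the class of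
`n ∈ H⁰(G; ℤ)` to the class of the cocycle `k`. -/
def Transgresses (n : ℤ) (k : (Fin 4 → G) → ℤ) : Prop :=
  ∃ (c₀ : (Fin 0 → G) → M₀) (c₁ : (Fin 1 → G) → M₁) (c₂ : (Fin 2 → G) → M₂)
    (c₃ : (Fin 3 → G) → M₃), E.ε (c₀ default) = n ∧
    cochainPush G E.d₁ 1 c₁ = cochainD ρ₀ 0 c₀ ∧ cochainPush G E.d₂ 2 c₂ = cochainD ρ₁ 1 c₁ ∧
    cochainPush G E.d₃ 3 c₃ = cochainD ρ₂ 2 c₂ ∧ cochainPush G E.ι 4 k = cochainD ρ₃ 3 c₃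

/-- The differential on cochains with coefficients in the trivial representation `ℤ`. -/
noncomputable abbrev _root_.trivialD (G : Type) [Group G] (n : ℕ) :
    ((Fin n → G) → ℤ) →ₗ[ℤ] ((Fin (n + 1) → G) → ℤ) :=
  cochainD (Representation.trivial ℤ G ℤ) n

theorem push_ε (n : ℕ) (f : (Fin n → G) → M₀) :
    trivialD G n (cochainPush G E.ε n f) = cochainPush G E.ε (n + 1) (cochainD ρ₀ n f) :=
  cochainD_cochainPush (fun g a => E.ε_equivariant g a) n f

theorem push_d₁ (n : ℕ) (f : (Fin n → G) → M₁) :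
    cochainD ρ₀ n (cochainPush G E.d₁ n f) = cochainPush G E.d₁ (n + 1) (cochainD ρ₁ n f) :=
  cochainD_cochainPush E.d₁_equivariant n f

theorem push_d₂ (n : ℕ) (f : (Fin n → G) → M₂) :
    cochainD ρ₁ n (cochainPush G E.d₂ n f) = cochainPush G E.d₂ (n + 1) (cochainD ρ₂ n f) :=
  cochainD_cochainPush E.d₂_equivariant n f

theorem push_d₃ (n : ℕ) (f : (Fin n → G) → M₃) :
    cochainD ρ₂ n (cochainPush G E.d₃ n f) = cochainPush G E.d₃ (n + 1) (cochainD ρ₃ n f) :=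
  cochainD_cochainPush E.d₃_equivariant n f

theorem push_ι (n : ℕ) (f : (Fin n → G) → ℤ) :
    cochainD ρ₃ n (cochainPush G E.ι n f) = cochainPush G E.ι (n + 1) (trivialD G n f) :=
  cochainD_cochainPush (fun g a => E.ι_equivariant g a) n f

/-- Iterated snake lemma: the differential of each lift is killed by the next map of the extension,
so it lifts again. The start works because `G` acts trivially on `ℤ`. -/
theorem exists_transgresses (n : ℤ) : ∃ k, E.Transgresses n k := by
  obtain ⟨a, ha⟩ := E.ε_surjective n
  obtain ⟨c₁, h₁⟩ := cochainPush_exact E.exact₀ (f := cochainD ρ₀ 0 fun _ => a) (by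
    rw [← push_ε]; exact cochainD_zero_eq_zero_iff.2 fun g => rfl)
  obtain ⟨c₂, h₂⟩ := cochainPush_exact E.exact₁ (f := cochainD ρ₁ 1 c₁) (by
    rw [← push_d₁, h₁, cochainD_cochainD])
  obtain ⟨c₃, h₃⟩ := cochainPush_exact E.exact₂ (f := cochainD ρ₂ 2 c₂) (by
    rw [← push_d₂, h₂, cochainD_cochainD])
  obtain ⟨k, hk⟩ := cochainPush_exact E.exact₃ (f := cochainD ρ₃ 3 c₃) (by
    rw [← push_d₃, h₃, cochainD_cochainD])
  exact ⟨k, fun _ => a, c₁, c₂, c₃, ha, h₁, h₂, h₃, hk⟩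

variable {E}

theorem Transgresses.trivialD_eq_zero {n : ℤ} {k : (Fin 4 → G) → ℤ} (h : E.Transgresses n k) :
    trivialD G 4 k = 0 := by
  obtain ⟨c₀, c₁, c₂, c₃, h₀, h₁, h₂, h₃, hk⟩ := h
  apply cochainPush_injective E.ι_injective
  rw [← push_ι, hk, cochainD_cochainD, map_zero]

theorem Transgresses.zsmul {n : ℤ} {k : (Fin 4 → G) → ℤ} (h : E.Transgresses n k) (a : ℤ) :
    E.Transgresses (a * n) (a • k) := by
  obtain ⟨c₀, c₁, c₂, c₃, h₀, h₁, h₂, h₃, hk⟩ := h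
  exact ⟨a • c₀, a • c₁, a • c₂, a • c₃, by simp [h₀], by simp only [map_zsmul, h₁],
    by simp only [map_zsmul, h₂], by simp only [map_zsmul, h₃], by simp only [map_zsmul, hk]⟩

theorem Transgresses.sub {n n' : ℤ} {k k' : (Fin 4 → G) → ℤ} (h : E.Transgresses n k)
    (h' : E.Transgresses n' k') : E.Transgresses (n - n') (k - k') := by
  obtain ⟨c₀, c₁, c₂, c₃, h₀, h₁, h₂, h₃, hk⟩ := h
  obtain ⟨c₀', c₁', c₂', c₃', h₀', h₁', h₂', h₃', hk'⟩ := h'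
  exact ⟨c₀ - c₀', c₁ - c₁', c₂ - c₂', c₃ - c₃', by simp [h₀, h₀'], by simp only [map_sub, h₁, h₁'],
    by simp only [map_sub, h₂, h₂'], by simp only [map_sub, h₃, h₃'],
    by simp only [map_sub, hk, hk']⟩

/-- With `Transgresses.sub`, this makes the connecting map well defined on classes. Each lift `cᵢ`,
once corrected by a coboundary, comes from the next module, and the last correction bounds `k`. -/
theorem Transgresses.exists_trivialD_eq {k : (Fin 4 → G) → ℤ} (h : E.Transgresses 0 k) :
    ∃ b, trivialD G 3 b = k := by
  obtain ⟨c₀, c₁, c₂, c₃, h₀, h₁, h₂, h₃, hk⟩ := h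
  obtain ⟨b₁, hb₁⟩ := cochainPush_exact E.exact₀ (f := c₀) (by
    funext g; rw [Subsingleton.elim g default]; exact h₀)
  obtain ⟨b₂, hb₂⟩ := cochainPush_exact E.exact₁ (f := c₁ - cochainD ρ₁ 0 b₁) (by
    rw [map_sub, ← push_d₁, hb₁, h₁, sub_self])
  obtain ⟨b₃, hb₃⟩ := cochainPush_exact E.exact₂ (f := c₂ - cochainD ρ₂ 1 b₂) (by
    rw [map_sub, ← push_d₂, hb₂, h₂, map_sub, cochainD_cochainD, sub_zero, sub_self])
  obtain ⟨b₄, hb₄⟩ := cochainPush_exact E.exact₃ (f := c₃ - cochainD ρ₃ 2 b₃) (by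
    rw [map_sub, ← push_d₃, hb₃, h₃, map_sub, cochainD_cochainD, sub_zero, sub_self])
  refine ⟨b₄, cochainPush_injective E.ι_injective 4 ?_⟩
  rw [← push_ι, hb₄, hk, map_sub, cochainD_cochainD, sub_zero]

/-- An invariant lift is already a 0-cocycle, so all later lifts may be taken to be zero. -/
theorem transgresses_zero_of_invariant {n : ℤ} {a : M₀} (ha : ∀ g, ρ₀ g a = a) (hn : E.ε a = n) :
    E.Transgresses n 0 :=
  ⟨fun _ => a, 0, 0, 0, hn, by rw [map_zero, cochainD_zero_eq_zero_iff.2 ha], by simp, by simp,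
    by simp⟩

section Trace

variable [Fintype G] {m : ℤ}

/-- The connecting maps are run backwards. Each of the obstructions, in `H⁴(M₃)`, `H³(M₂)`, `H²(M₁)`
and `H¹(M₀)`, dies after multiplication by `m`, which accounts for `m⁴`. -/
theorem exists_transgresses_smul (h₀ : TraceEq ρ₀ m) (h₁ : TraceEq ρ₁ m) (h₂ : TraceEq ρ₂ m)
    (h₃ : TraceEq ρ₃ m) {u : (Fin 4 → G) → ℤ} (hu : trivialD G 4 u = 0) :
    ∃ n, E.Transgresses n (m ^ 4 • u) := by
  obtain ⟨e₃, he₃⟩ := h₃.smul_eq_cochainD (f := cochainPush G E.ι 4 u) (by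
    rw [push_ι, hu, map_zero])
  obtain ⟨e₂, he₂⟩ := h₂.smul_eq_cochainD (f := cochainPush G E.d₃ 3 e₃) (by
    rw [push_d₃, he₃, map_zsmul, cochainPush_cochainPush E.exact₃, smul_zero])
  obtain ⟨e₁, he₁⟩ := h₁.smul_eq_cochainD (f := cochainPush G E.d₂ 2 e₂) (by
    rw [push_d₂, he₂, map_zsmul, cochainPush_cochainPush E.exact₂, smul_zero])
  obtain ⟨e₀, he₀⟩ := h₀.smul_eq_cochainD (f := cochainPush G E.d₁ 1 e₁) (by
    rw [push_d₁, he₁, map_zsmul, cochainPush_cochainPush E.exact₁, smul_zero])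
  -- The powers of `m` make consecutive lifts compatible, since each `eᵢ` bounds only `m` times the
  -- image of the previous one.
  refine ⟨E.ε (e₀ default), e₀, m • e₁, m ^ 2 • e₂, m ^ 3 • e₃, rfl, ?_, ?_, ?_, ?_⟩
  · rw [map_zsmul, he₀]
  · rw [map_zsmul, map_zsmul, he₁, smul_smul, sq]
  · rw [map_zsmul, map_zsmul, he₂, smul_smul, ← pow_succ]
  · rw [map_zsmul, map_zsmul, he₃, smul_smul, ← pow_succ]

/-- This controls the kernel of the connecting map up to `m³`. The lifts are corrected from the left
end, at the cost of one factor `m` each for `H³(M₃)`, `H²(M₂)` and `H¹(M₁)`; what remains in `M₀` is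
a 0-cocycle. -/
theorem Transgresses.exists_invariant (h₁ : TraceEq ρ₁ m) (h₂ : TraceEq ρ₂ m)
    (h₃ : TraceEq ρ₃ m) {n : ℤ} {b : (Fin 3 → G) → ℤ} (h : E.Transgresses n (trivialD G 3 b)) :
    ∃ a, (∀ g, ρ₀ g a = a) ∧ E.ε a = m ^ 3 * n := by
  obtain ⟨c₀, c₁, c₂, c₃, H₀, H₁, H₂, H₃, hk⟩ := h
  obtain ⟨e₂, he₂⟩ := h₃.smul_eq_cochainD (f := c₃ - cochainPush G E.ι 3 b) (by
    rw [map_sub, push_ι, hk, sub_self])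
  obtain ⟨e₁, he₁⟩ := h₂.smul_eq_cochainD (f := m • c₂ - cochainPush G E.d₃ 2 e₂) (by
    rw [map_sub, push_d₃, he₂, map_zsmul, map_zsmul, map_sub, cochainPush_cochainPush E.exact₃,
      H₃, sub_zero, sub_self])
  obtain ⟨e₀, he₀⟩ := h₁.smul_eq_cochainD (f := m ^ 2 • c₁ - cochainPush G E.d₂ 1 e₁) (by
    rw [map_sub, push_d₂, he₁, map_zsmul, map_zsmul, map_sub, cochainPush_cochainPush E.exact₂,
      map_zsmul, H₂, sub_zero, smul_smul, sq, sub_self])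
  refine ⟨(m ^ 3 • c₀ - cochainPush G E.d₁ 0 e₀) default, cochainD_zero_eq_zero_iff.1 ?_, ?_⟩
  · rw [map_sub, push_d₁, he₀, map_zsmul, map_zsmul, map_sub, cochainPush_cochainPush E.exact₁,
      map_zsmul, H₁, sub_zero, smul_smul, pow_succ' m 2, sub_self]
  · have : E.ε (cochainPush G E.d₁ 0 e₀ default) = 0 := E.exact₀.apply_apply_eq_zero _
    rw [Pi.sub_apply, map_sub, this, Pi.smul_apply, map_zsmul, H₀, sub_zero, smul_eq_mul]

end Trace

/-- `E.HasDegree θ r` says that `E` has an endomorphism which is semilinear along `θ`, and which is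
multiplication by `r` on the left end and the identity on the right end. -/
def HasDegree (E : FourExtension ρ₀ ρ₁ ρ₂ ρ₃) (θ : G →* G) (r : ℤ) : Prop :=
  ∃ (T₀ : M₀ →ₗ[ℤ] M₀) (T₁ : M₁ →ₗ[ℤ] M₁) (T₂ : M₂ →ₗ[ℤ] M₂) (T₃ : M₃ →ₗ[ℤ] M₃),
    (∀ g a, T₀ (ρ₀ (θ g) a) = ρ₀ g (T₀ a)) ∧ (∀ g a, T₁ (ρ₁ (θ g) a) = ρ₁ g (T₁ a)) ∧
    (∀ g a, T₂ (ρ₂ (θ g) a) = ρ₂ g (T₂ a)) ∧ (∀ g a, T₃ (ρ₃ (θ g) a) = ρ₃ g (T₃ a)) ∧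
    (∀ a, E.ε (T₀ a) = E.ε a) ∧ (∀ a, T₀ (E.d₁ a) = E.d₁ (T₁ a)) ∧
    (∀ a, T₁ (E.d₂ a) = E.d₂ (T₂ a)) ∧ (∀ a, T₂ (E.d₃ a) = E.d₃ (T₃ a)) ∧
    (∀ n, T₃ (E.ι n) = E.ι (r * n))

theorem HasDegree.comp {θ η : G →* G} {r s : ℤ} (hθ : E.HasDegree θ r) (hη : E.HasDegree η s) :
    E.HasDegree (θ.comp η) (r * s) := by
  obtain ⟨T₀, T₁, T₂, T₃, h₀, h₁, h₂, h₃, hε, hd₁, hd₂, hd₃, hι⟩ := hθ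
  obtain ⟨S₀, S₁, S₂, S₃, g₀, g₁, g₂, g₃, gε, gd₁, gd₂, gd₃, gι⟩ := hη
  exact ⟨S₀ ∘ₗ T₀, S₁ ∘ₗ T₁, S₂ ∘ₗ T₂, S₃ ∘ₗ T₃, by simp [h₀, g₀], by simp [h₁, g₁],
    by simp [h₂, g₂], by simp [h₃, g₃], by simp [hε, gε], by simp [hd₁, gd₁], by simp [hd₂, gd₂],
    by simp [hd₃, gd₃], fun n => by simp only [LinearMap.comp_apply, hι, gι]; congr 1; ring⟩

/-- A chain of lifts, pulled back along `θ` and pushed forward by the semilinear maps `Tᵢ`, is again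
a chain of lifts. Its right end is unchanged and its left end acquires the factor `r`. -/
theorem Transgresses.map {θ : G →* G} {r : ℤ} (hθ : E.HasDegree θ r) {n : ℤ}
    {k : (Fin 4 → G) → ℤ} (h : E.Transgresses n k) :
    E.Transgresses n (r • cochainMap θ (LinearMap.id : ℤ →ₗ[ℤ] ℤ) 4 k) := by
  obtain ⟨T₀, T₁, T₂, T₃, h₀, h₁, h₂, h₃, hε, hd₁, hd₂, hd₃, hι⟩ := hθ
  obtain ⟨c₀, c₁, c₂, c₃, H₀, H₁, H₂, H₃, hk⟩ := h
  refine ⟨cochainMap θ T₀ 0 c₀, cochainMap θ T₁ 1 c₁, cochainMap θ T₂ 2 c₂, cochainMap θ T₃ 3 c₃,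
    ?_, ?_, ?_, ?_, ?_⟩
  · rw [cochainMap_apply, hε, Subsingleton.elim (θ ∘ default) default, H₀]
  · rw [cochainD_cochainMap h₀, ← H₁]
    exact funext fun g => (hd₁ _).symm
  · rw [cochainD_cochainMap h₁, ← H₂]
    exact funext fun g => (hd₂ _).symm
  · rw [cochainD_cochainMap h₂, ← H₃]
    exact funext fun g => (hd₃ _).symm
  · rw [cochainD_cochainMap h₃, ← hk]
    exact funext fun g => (hι _).symm

end FourExtension

/-! ### Classes in `H⁴(G; ℤ)` represented by explicit cocycles -/

section CohomologyClass

variable {G : Type} [Group G]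

/-- The class in `H⁴(G; ℤ)` of a cocycle. -/
noncomputable def cohomologyClass (k : (Fin 4 → G) → ℤ) (hk : trivialD G 4 k = 0) :
    integralCohomology G 4 :=
  groupCohomology.π (Rep.trivial ℤ G ℤ) 4
    (groupCohomology.cocyclesMk (A := Rep.trivial ℤ G ℤ) k hk)

theorem iCocycles_injective (x y : groupCohomology.cocycles (Rep.trivial ℤ G ℤ) 4)
    (h : (groupCohomology.iCocycles (Rep.trivial ℤ G ℤ) 4).hom x =
      (groupCohomology.iCocycles (Rep.trivial ℤ G ℤ) 4).hom y) : x = y :=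
  (ModuleCat.mono_iff_injective (groupCohomology.iCocycles (Rep.trivial ℤ G ℤ) 4)).1
    inferInstance h

theorem exists_cohomologyClass_eq (u : integralCohomology G 4) :
    ∃ k hk, cohomologyClass k hk = u := by
  induction u using groupCohomology_induction_on with
  | h x =>
  have hx : trivialD G 4 ((groupCohomology.iCocycles (Rep.trivial ℤ G ℤ) 4).hom x) = 0 := by
    have := congrArg (fun φ => φ.hom x)
      ((groupCohomology.inhomogeneousCochains (Rep.trivial ℤ G ℤ)).iCycles_d 4 5)
    rw [groupCohomology.inhomogeneousCochains.d_def] at this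
    exact this
  refine ⟨_, hx, congrArg _ (iCocycles_injective _ _ ?_)⟩
  exact groupCohomology.iCocycles_mk _ hx

theorem cohomologyClass_sub {k l : (Fin 4 → G) → ℤ} (hk : trivialD G 4 k = 0)
    (hl : trivialD G 4 l = 0) (hkl : trivialD G 4 (k - l) = 0) :
    cohomologyClass (k - l) hkl = cohomologyClass k hk - cohomologyClass l hl := by
  refine Eq.trans (congrArg (groupCohomology.π (Rep.trivial ℤ G ℤ) 4).hom (iCocycles_injective _ _ ?_))
    (map_sub (groupCohomology.π (Rep.trivial ℤ G ℤ) 4).hom _ _)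
  refine (groupCohomology.iCocycles_mk _ _).trans (Eq.trans (congrArg₂ (· - ·) ?_ ?_)
    (map_sub (groupCohomology.iCocycles (Rep.trivial ℤ G ℤ) 4).hom _ _).symm)
  · exact (groupCohomology.iCocycles_mk (A := Rep.trivial ℤ G ℤ) k hk).symm
  · exact (groupCohomology.iCocycles_mk (A := Rep.trivial ℤ G ℤ) l hl).symm

theorem cohomologyClass_zsmul (a : ℤ) {k : (Fin 4 → G) → ℤ} (hk : trivialD G 4 k = 0)
    (hak : trivialD G 4 (a • k) = 0) :
    cohomologyClass (a • k) hak = a • cohomologyClass k hk := by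
  refine Eq.trans (congrArg (groupCohomology.π (Rep.trivial ℤ G ℤ) 4).hom (iCocycles_injective _ _ ?_))
    (map_zsmul (groupCohomology.π (Rep.trivial ℤ G ℤ) 4).hom _ _)
  refine (groupCohomology.iCocycles_mk _ _).trans (Eq.trans (congrArg (a • ·) ?_)
    (map_zsmul (groupCohomology.iCocycles (Rep.trivial ℤ G ℤ) 4).hom _ _).symm)
  exact (groupCohomology.iCocycles_mk (A := Rep.trivial ℤ G ℤ) k hk).symm

theorem cohomologyClass_eq_zero_iff {k : (Fin 4 → G) → ℤ} (hk : trivialD G 4 k = 0) :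
    cohomologyClass k hk = 0 ↔ ∃ b, trivialD G 3 b = k := by
  let K := groupCohomology.inhomogeneousCochains (Rep.trivial ℤ G ℤ)
  have hexact := ShortComplex.exact_of_g_is_cokernel
    (ShortComplex.mk _ _ (K.toCycles_comp_homologyπ 3 4)) (K.homologyIsCokernel 3 4 (by simp))
  rw [ShortComplex.moduleCat_exact_iff] at hexact
  have hd (b : (Fin 3 → G) → ℤ) :
      (groupCohomology.iCocycles (Rep.trivial ℤ G ℤ) 4).hom ((K.toCycles 3 4).hom b) =
        trivialD G 3 b := by
    have := congrArg (fun φ => φ.hom b) (K.toCycles_i 3 4)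
    rw [groupCohomology.inhomogeneousCochains.d_def] at this
    exact this
  constructor
  · intro h
    obtain ⟨b, hb⟩ := hexact _ h
    refine ⟨b, (hd b).symm.trans ?_⟩
    refine (congrArg (groupCohomology.iCocycles (Rep.trivial ℤ G ℤ) 4).hom hb).trans ?_
    exact groupCohomology.iCocycles_mk (A := Rep.trivial ℤ G ℤ) k hk
  · rintro ⟨b, rfl⟩
    have := congrArg (fun φ => φ.hom b) (K.toCycles_comp_homologyπ 3 4)
    refine Eq.trans (congrArg (groupCohomology.π (Rep.trivial ℤ G ℤ) 4).hom (iCocycles_injective _ _ ?_)) this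
    exact (groupCohomology.iCocycles_mk (A := Rep.trivial ℤ G ℤ) _ hk).trans (hd b).symm

theorem cohomologyPullback_cohomologyClass (θ : G →* G) {k : (Fin 4 → G) → ℤ}
    (hk : trivialD G 4 k = 0)
    (hk' : trivialD G 4 (cochainMap θ (LinearMap.id : ℤ →ₗ[ℤ] ℤ) 4 k) = 0) :
    cohomologyPullback θ 4 (cohomologyClass k hk) = cohomologyClass _ hk' := by
  let φ : Rep.res θ (Rep.trivial ℤ G ℤ) ⟶ Rep.trivial ℤ G ℤ :=
    Rep.ofHom ⟨LinearMap.id, fun _ => rfl⟩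
  let x := groupCohomology.cocyclesMk (A := Rep.trivial ℤ G ℤ) k hk
  have h₁ := congrArg (fun ψ => ψ.hom x) (groupCohomology.π_map θ φ 4)
  refine Eq.trans h₁ (congrArg (groupCohomology.π (Rep.trivial ℤ G ℤ) 4).hom (iCocycles_injective _ _ ?_))
  have h₂ := congrArg (fun ψ => ψ.hom x)
    (HomologicalComplex.cyclesMap_i (groupCohomology.cochainsMap θ φ) 4)
  refine Eq.trans h₂ (Eq.trans ?_
    (groupCohomology.iCocycles_mk (A := Rep.trivial ℤ G ℤ) _ hk').symm)
  exact congrArg ((groupCohomology.cochainsMap θ φ).f 4).hom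
    (groupCohomology.iCocycles_mk (A := Rep.trivial ℤ G ℤ) k hk)

end CohomologyClass

/-! ### The characteristic class of a four-term extension -/

namespace FourExtension

variable {G M₀ M₁ M₂ M₃ : Type} [Group G] [Fintype G] [AddCommGroup M₀] [AddCommGroup M₁]
    [AddCommGroup M₂] [AddCommGroup M₃] {ρ₀ : Representation ℤ G M₀} {ρ₁ : Representation ℤ G M₁}
    {ρ₂ : Representation ℤ G M₂} {ρ₃ : Representation ℤ G M₃} (E : FourExtension ρ₀ ρ₁ ρ₂ ρ₃)

/-- The characteristic class of a four-term extension whose terms have cohomology annihilated by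
`m`, when the image of the invariants in `ℤ` is generated by some `d` prime to `m`. -/
theorem exists_characteristic_class {m d : ℤ} (hmd : IsCoprime m d) (h₀ : TraceEq ρ₀ m)
    (h₁ : TraceEq ρ₁ m) (h₂ : TraceEq ρ₂ m) (h₃ : TraceEq ρ₃ m)
    (hd : ∃ a, (∀ g, ρ₀ g a = a) ∧ E.ε a = d)
    (hd' : ∀ a, (∀ g, ρ₀ g a = a) → d ∣ E.ε a) :
    ∃ κ : integralCohomology G 4, (∀ u, ∃ n : ℤ, m ^ 4 • u = n • κ) ∧
      (∀ n : ℤ, n • κ = 0 ↔ d ∣ n) ∧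
      ∀ θ r, E.HasDegree θ r → r • cohomologyPullback θ 4 κ = κ := by
  obtain ⟨k, hk⟩ := E.exists_transgresses 1
  have hk₀ := hk.trivialD_eq_zero
  have hzsmul (n : ℤ) : E.Transgresses n (n • k) := by simpa using hk.zsmul n
  have heq {n : ℤ} {a b : (Fin 4 → G) → ℤ} (ha : E.Transgresses n a) (hb : E.Transgresses n b) :
      cohomologyClass a ha.trivialD_eq_zero = cohomologyClass b hb.trivialD_eq_zero := by
    have hab := ha.sub hb
    rw [sub_self] at hab
    rw [← sub_eq_zero, ← cohomologyClass_sub _ _ hab.trivialD_eq_zero, cohomologyClass_eq_zero_iff]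
    exact hab.exists_trivialD_eq
  refine ⟨cohomologyClass k hk₀, fun u => ?_, fun n => ?_, fun θ r hθ => ?_⟩
  · obtain ⟨u, hu, rfl⟩ := exists_cohomologyClass_eq u
    obtain ⟨n, hn⟩ := exists_transgresses_smul (E := E) h₀ h₁ h₂ h₃ hu
    refine ⟨n, ?_⟩
    rw [← cohomologyClass_zsmul _ _ hn.trivialD_eq_zero,
      ← cohomologyClass_zsmul _ _ (hzsmul n).trivialD_eq_zero]
    exact heq hn (hzsmul n)
  · rw [← cohomologyClass_zsmul _ _ (hzsmul n).trivialD_eq_zero, cohomologyClass_eq_zero_iff]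
    constructor
    · rintro ⟨b, hb⟩
      -- If `nκ = 0`, then `m³n` is the image of an invariant, so `d ∣ m³n`; coprimality removes
      -- `m³`.
      obtain ⟨a, ha, han⟩ := Transgresses.exists_invariant (E := E) (b := b) h₁ h₂ h₃
        (hb ▸ hzsmul n)
      exact hmd.symm.pow_right.dvd_of_dvd_mul_left (han ▸ hd' a ha)
    · rintro ⟨c, rfl⟩
      obtain ⟨a, ha, had⟩ := hd
      -- The integer `dc` transgresses both to `dc • k` and, through an invariant lift, to `0`.
      have h := ((hzsmul (d * c)).sub ((transgresses_zero_of_invariant ha had).zsmul c))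
      rw [smul_zero, sub_zero, mul_comm, sub_self] at h
      rw [mul_comm]
      exact h.exists_trivialD_eq
  · have h := hk.map hθ
    have hθk : trivialD G 4 (cochainMap θ (LinearMap.id : ℤ →ₗ[ℤ] ℤ) 4 k) = 0 := by
      rw [trivialD, cochainD_cochainMap (ρ := Representation.trivial ℤ G ℤ) fun g a => rfl]
      exact (congrArg _ hk₀).trans (map_zero _)
    rw [cohomologyPullback_cohomologyClass _ _ hθk,
      ← cohomologyClass_zsmul _ _ h.trivialD_eq_zero]
    exact heq h hk

end FourExtension

/-! ### The integral group ring of a cyclic group -/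

/-- The integral group ring of the cyclic group of order `n`. -/
abbrev CyclicRing (n : ℕ) : Type := AddMonoidAlgebra ℤ (ZMod n)

namespace CyclicRing

variable {n : ℕ}

/-- The basis element of the group ring given by `i`. -/
noncomputable def X (i : ZMod n) : CyclicRing n := AddMonoidAlgebra.single i 1

theorem X_add (i j : ZMod n) : X (i + j) = X i * X j := by
  simp [X, AddMonoidAlgebra.single_mul_single]

@[simp] theorem X_zero : X (0 : ZMod n) = 1 := rfl

theorem X_nsmul (i : ZMod n) (k : ℕ) : X ((k : ZMod n) * i) = X i ^ k := by
  induction k with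
  | zero => simp
  | succ k ih => rw [pow_succ, ← ih, ← X_add]; congr 1; push_cast; ring

theorem X_natCast (k : ℕ) : X (k : ZMod n) = X 1 ^ k := by
  rw [← X_nsmul, mul_one]

theorem single_eq (i : ZMod n) (c : ℤ) : AddMonoidAlgebra.single i c = c • X i := by
  simp [X, AddMonoidAlgebra.smul_single]

theorem induction_X {P : CyclicRing n → Prop} (f : CyclicRing n) (zero : P 0)
    (add : ∀ f g, P f → P g → P (f + g)) (smul : ∀ (c : ℤ) i, P (c • X i)) : P f :=
  AddMonoidAlgebra.induction_linear f zero add fun i c => single_eq i c ▸ smul c i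

theorem hom_ext {A : Type*} [AddCommGroup A] {S T : CyclicRing n →+ A}
    (h : ∀ i, S (X i) = T (X i)) : S = T := by
  refine AddMonoidHom.ext fun f => ?_
  induction f using induction_X with
  | zero => simp
  | add f g hf hg => simp [hf, hg]
  | smul c i => rw [map_zsmul, map_zsmul, h]

/-- The augmentation of the group ring. -/
noncomputable def aug : CyclicRing n →+* ℤ :=
  (AddMonoidAlgebra.lift ℤ ℤ (ZMod n) 1 : CyclicRing n →ₐ[ℤ] ℤ).toRingHom

@[simp] theorem aug_X (i : ZMod n) : aug (X i) = 1 := by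
  simp [aug, X]

/-- The endomorphism of the group ring induced by multiplication by `k`. -/
noncomputable def scale (k : ZMod n) : CyclicRing n →+* CyclicRing n :=
  AddMonoidAlgebra.mapDomainRingHom ℤ (AddMonoidHom.mulLeft k)

@[simp] theorem scale_X (k i : ZMod n) : scale k (X i) = X (k * i) := by
  simp [scale, X]

@[simp] theorem scale_one (f : CyclicRing n) : scale 1 f = f :=
  DFunLike.congr_fun (hom_ext (S := (scale 1).toAddMonoidHom) (T := AddMonoidHom.id _)
    (by simp)) f

@[simp] theorem scale_scale (k l : ZMod n) (f : CyclicRing n) :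
    scale k (scale l f) = scale (k * l) f :=
  DFunLike.congr_fun (hom_ext (S := ((scale k).comp (scale l)).toAddMonoidHom)
    (T := (scale (k * l)).toAddMonoidHom) (by simp [mul_assoc])) f

@[simp] theorem aug_scale (k : ZMod n) (f : CyclicRing n) : aug (scale k f) = aug f :=
  DFunLike.congr_fun (hom_ext (S := (aug.comp (scale k)).toAddMonoidHom)
    (T := (aug (n := n)).toAddMonoidHom) (by simp)) f

/-- The coefficient at `i`. -/
noncomputable def coeffAt (i : ZMod n) : CyclicRing n →ₗ[ℤ] ℤ where
  toFun f := f.coeff i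
  map_add' _ _ := rfl
  map_smul' _ _ := rfl

theorem coeffAt_X (i j : ZMod n) : coeffAt i (X j) = if j = i then 1 else 0 := by
  exact Finsupp.single_apply

theorem coeffAt_X_mul (i j : ZMod n) (f : CyclicRing n) :
    coeffAt i (X j * f) = coeffAt (i - j) f := by
  have := AddMonoidAlgebra.coeff_single_mul_apply f (1 : ℤ) j i
  rw [one_mul, neg_add_eq_sub] at this
  exact this

theorem ext_coeffAt {f g : CyclicRing n} (h : ∀ i, coeffAt i f = coeffAt i g) : f = g :=
  AddMonoidAlgebra.coeff_injective (Finsupp.ext h)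

variable [NeZero n]

theorem sum_coeffAt (f : CyclicRing n) : ∑ i, coeffAt i f • X i = f := by
  refine ext_coeffAt fun j => ?_
  simp only [map_sum, map_zsmul, coeffAt_X]
  simp

theorem dvd_sub_aug (f : CyclicRing n) : X 1 - 1 ∣ f - (aug f : CyclicRing n) := by
  induction f using induction_X with
  | zero => simp
  | add f g hf hg =>
    rw [map_add, Int.cast_add, add_sub_add_comm]
    exact dvd_add hf hg
  | smul c i =>
    have : c • X i - ((aug (c • X i) : ℤ) : CyclicRing n) =
        (c : CyclicRing n) * (X 1 ^ i.val - 1) := by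
      rw [← X_natCast, ZMod.natCast_zmod_val, map_zsmul, aug_X, zsmul_eq_mul]
      simp [mul_sub]
    rw [this]
    exact dvd_mul_of_dvd_right (sub_one_dvd_pow_sub_one _ _) _

theorem exists_of_aug_eq_zero {f : CyclicRing n} (hf : aug f = 0) : ∃ g, f = (X 1 - 1) * g := by
  have := dvd_sub_aug f
  rwa [hf, Int.cast_zero, sub_zero] at this

/-- The normElt element. -/
noncomputable def normElt : CyclicRing n := ∑ i, X i

@[simp] theorem aug_normElt : aug (normElt : CyclicRing n) = n := by
  simp [normElt, ZMod.card]

theorem X_mul_normElt (i : ZMod n) : X i * normElt = normElt := by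
  rw [normElt, Finset.mul_sum, ← Equiv.sum_comp (Equiv.addLeft i) X]
  simp [X_add]

theorem mul_normElt (f : CyclicRing n) : f * normElt = aug f • normElt := by
  induction f using induction_X with
  | zero => simp
  | add f g hf hg => rw [add_mul, hf, hg, map_add, add_smul]
  | smul c i => rw [smul_mul_assoc, X_mul_normElt, map_zsmul, aug_X, smul_eq_mul, mul_one]

theorem scale_normElt {k : ZMod n} (hk : IsUnit k) : scale k normElt = normElt := by
  obtain ⟨k, rfl⟩ := hk
  simp only [normElt, map_sum, scale_X]
  exact Equiv.sum_comp k.mulLeft X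

theorem smul_normElt_injective {a b : ℤ} (h : a • (normElt : CyclicRing n) = b • normElt) : a = b := by
  have := congrArg aug h
  simpa [NeZero.ne n] using this

/-- Being killed by `X 1 - 1` means being invariant under every translation, so all coefficients
agree. -/
theorem exists_of_mul_eq_zero {f : CyclicRing n} (hf : (X 1 - 1) * f = 0) :
    ∃ a : ℤ, f = a • normElt := by
  have h (i : ZMod n) : X i * f = f := by
    have := sub_one_dvd_pow_sub_one (X (1 : ZMod n)) i.val
    rw [← X_natCast, ZMod.natCast_zmod_val] at this
    obtain ⟨g, hg⟩ := this
    rw [← sub_eq_zero, ← sub_one_mul, hg, mul_right_comm, hf, zero_mul]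
  refine ⟨coeffAt 0 f, ext_coeffAt fun i => ?_⟩
  have hi := congrArg (coeffAt i) (h i)
  rw [coeffAt_X_mul, sub_self] at hi
  rw [← hi, map_zsmul, normElt, map_sum]
  simp [coeffAt_X]

end CyclicRing

/-! ### The extension that detects the `p`-part -/

namespace Q16p

open CyclicRing

variable {p : ℕ}

/-- The exponent of the `C_p`-component. -/
def shift (g : Q16p p) : ZMod p := g.left.toAdd

/-- The sign through which an element acts on `C_p`. -/
def sgn (g : Q16p p) : ℤˣ := Q16.sign g.right

theorem shift_mul (g h : Q16p p) : shift (g * h) = shift g + ((sgn g : ℤ) : ZMod p) * shift h := by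
  change shift g + (sgn g : ℤ) • shift h = _
  rw [zsmul_eq_mul]

theorem sgn_mul (g h : Q16p p) : sgn (g * h) = sgn g * sgn h :=
  map_mul Q16.sign g.right h.right

@[simp] theorem shift_one : shift (1 : Q16p p) = 0 := rfl

@[simp] theorem sgn_one : sgn (1 : Q16p p) = 1 := map_one Q16.sign

theorem unit_mul_self (u : ℤˣ) : ((u : ℤ) : ZMod p) * ((u : ℤ) : ZMod p) = 1 := by
  rw [← Int.cast_mul, Int.units_coe_mul_self, Int.cast_one]

theorem shift_inv (g : Q16p p) : shift g⁻¹ = -(((sgn g : ℤ) : ZMod p) * shift g) := by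
  have h := shift_mul g g⁻¹
  rw [mul_inv_cancel, shift_one] at h
  linear_combination (-((sgn g : ℤ) : ZMod p)) * h - shift g⁻¹ * unit_mul_self (p := p) (sgn g)

theorem sgn_inv (g : Q16p p) : sgn g⁻¹ = sgn g := by
  rw [sgn, SemidirectProduct.inv_right, map_inv, Int.units_inv_eq_self, sgn]

/-- The action on the group ring of `C_p = G / Q₁₆`. -/
noncomputable def cyclicRep (p : ℕ) : Representation ℤ (Q16p p) (CyclicRing p) where
  toFun g := LinearMap.mulLeft ℤ (X (shift g)) ∘ₗ
    (scale ((sgn g : ℤ) : ZMod p)).toAddMonoidHom.toIntLinearMap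
  map_one' := by
    refine LinearMap.ext fun f => ?_
    simp
  map_mul' g h := by
    refine LinearMap.ext fun f => ?_
    simp [shift_mul, sgn_mul, X_add]

theorem cyclicRep_apply (g : Q16p p) (f : CyclicRing p) :
    cyclicRep p g f = X (shift g) * scale ((sgn g : ℤ) : ZMod p) f := rfl

/-- The action on the group ring of `C_p`, twisted by the sign. -/
noncomputable def signedRep (p : ℕ) : Representation ℤ (Q16p p) (CyclicRing p) where
  toFun g := (sgn g : ℤ) • cyclicRep p g
  map_one' := by simp
  map_mul' g h := by
    rw [sgn_mul, map_mul, Units.val_mul, smul_mul_smul_comm]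

theorem signedRep_apply (g : Q16p p) (f : CyclicRing p) :
    signedRep p g f = (sgn g : ℤ) • cyclicRep p g f := rfl

/-- The skew generator `z - z⁻¹` of the augmentation ideal. -/
noncomputable def skew (p : ℕ) : CyclicRing p := X 1 - X (-1)

theorem scale_skew (u : ℤˣ) : scale ((u : ℤ) : ZMod p) (skew p) = (u : ℤ) • skew p := by
  rcases Int.units_eq_one_or u with rfl | rfl <;> simp [skew]

theorem aug_skew : aug (skew p) = 0 := by simp [skew]

/-- Inversion negates `z - z⁻¹`, whereas it does not send `z - 1` to a multiple of itself by a sign.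
This is why the skew generator serves as differential; it exchanges the plain and the signed action.
-/
theorem cyclicRep_skew_mul (g : Q16p p) (f : CyclicRing p) :
    cyclicRep p g (skew p * f) = skew p * signedRep p g f := by
  rw [signedRep_apply, cyclicRep_apply, cyclicRep_apply, map_mul, scale_skew]
  simp only [zsmul_eq_mul]
  ring

theorem signedRep_skew_mul (g : Q16p p) (f : CyclicRing p) :
    signedRep p g (skew p * f) = skew p * cyclicRep p g f := by
  rw [signedRep_apply, cyclicRep_skew_mul, signedRep_apply, mul_smul_comm, smul_smul,
    Int.units_coe_mul_self, one_smul]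

/-- For `p` odd, `z = (z²)^((p+1)/2)`, so `z² - 1 = z(z - z⁻¹)` divides `z - 1`. Hence the skew
element generates the augmentation ideal too, and the usual periodic exactness carries over. -/
theorem exists_eq_skew_mul (hp : Odd p) : ∃ s, X 1 - 1 = skew p * s := by
  obtain ⟨k, hk⟩ := hp
  have h : X (1 : ZMod p) * X (-1) = 1 := by rw [← X_add]; simp
  have h₁ : (X 1 ^ 2) ^ (k + 1) = X (1 : ZMod p) := by
    rw [← pow_mul, ← X_natCast]
    congr 1
    have : 2 * (k + 1) = p + 1 := by omega
    rw [this]; simp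
  obtain ⟨s, hs⟩ := sub_one_dvd_pow_sub_one (X (1 : ZMod p) ^ 2) (k + 1)
  rw [h₁] at hs
  refine ⟨X 1 * s, ?_⟩
  rw [hs, skew]
  linear_combination s * h

variable [NeZero p]

theorem isUnit_sign (u : ℤˣ) : IsUnit ((u : ℤ) : ZMod p) :=
  IsUnit.of_mul_eq_one _ (unit_mul_self u)

theorem cyclicRep_normElt_mul (g : Q16p p) (f : CyclicRing p) :
    cyclicRep p g (normElt * f) = normElt * cyclicRep p g f := by
  rw [cyclicRep_apply, map_mul, scale_normElt (isUnit_sign _), cyclicRep_apply]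
  ring

theorem exists_of_skew_mul_eq_zero (hp : Odd p) {f : CyclicRing p} (hf : skew p * f = 0) :
    ∃ a : ℤ, f = a • normElt := by
  obtain ⟨s, hs⟩ := exists_eq_skew_mul hp
  exact exists_of_mul_eq_zero (by rw [hs, mul_right_comm, hf, zero_mul])

theorem skew_exact (hp : Odd p) {f : CyclicRing p} (hf : aug f = 0) : ∃ g, skew p * g = f := by
  obtain ⟨g, rfl⟩ := exists_of_aug_eq_zero hf
  obtain ⟨s, hs⟩ := exists_eq_skew_mul hp
  exact ⟨s * g, by rw [hs, mul_assoc]⟩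

theorem skew_mul_normElt : skew p * normElt = 0 := by rw [mul_normElt, aug_skew, zero_smul]

/-- The four-term extension coming from the periodic resolution of `C_p`. -/
noncomputable def cyclicExtension (hp : Odd p) :
    FourExtension (cyclicRep p) (signedRep p) (signedRep p) (cyclicRep p) where
  ε := aug.toAddMonoidHom.toIntLinearMap
  d₁ := LinearMap.mulLeft ℤ (skew p)
  d₂ := LinearMap.mulLeft ℤ normElt
  d₃ := LinearMap.mulLeft ℤ (skew p)
  ι := LinearMap.toSpanSingleton ℤ _ normElt
  ε_equivariant g a := by simp [cyclicRep_apply]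
  d₁_equivariant g a := (cyclicRep_skew_mul g a).symm
  d₂_equivariant g a := by
    rw [LinearMap.mulLeft_apply, LinearMap.mulLeft_apply, signedRep_apply, signedRep_apply,
      cyclicRep_normElt_mul, mul_smul_comm]
  d₃_equivariant g a := (signedRep_skew_mul g a).symm
  ι_equivariant g n := by
    rw [LinearMap.toSpanSingleton_apply, map_zsmul, cyclicRep_apply, scale_normElt (isUnit_sign _),
      X_mul_normElt]
  ε_surjective n := ⟨n, by simp⟩
  exact₀ f := by
    refine ⟨fun hf => skew_exact hp hf, ?_⟩
    rintro ⟨g, rfl⟩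
    simp [aug_skew]
  exact₁ f := by
    constructor
    · intro hf
      obtain ⟨a, rfl⟩ := exists_of_skew_mul_eq_zero hp hf
      exact ⟨a, by rw [LinearMap.mulLeft_apply, zsmul_eq_mul, mul_comm]⟩
    · rintro ⟨g, rfl⟩
      rw [LinearMap.mulLeft_apply, LinearMap.mulLeft_apply, ← mul_assoc, skew_mul_normElt, zero_mul]
  exact₂ f := by
    constructor
    · intro hf
      refine skew_exact hp ?_
      rw [LinearMap.mulLeft_apply, mul_comm, mul_normElt] at hf
      exact smul_normElt_injective (hf.trans (zero_smul ℤ _).symm)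
    · rintro ⟨g, rfl⟩
      simp only [LinearMap.mulLeft_apply]
      rw [← mul_assoc, mul_comm normElt, skew_mul_normElt, zero_mul]
  exact₃ f := by
    constructor
    · intro hf
      obtain ⟨a, rfl⟩ := exists_of_skew_mul_eq_zero hp hf
      exact ⟨a, rfl⟩
    · rintro ⟨a, rfl⟩
      rw [LinearMap.toSpanSingleton_apply, map_zsmul, LinearMap.mulLeft_apply, skew_mul_normElt,
        smul_zero]
  ι_injective _ _ h := smul_normElt_injective h

theorem cyclicExtension_ι (hp : Odd p) (n : ℤ) : (cyclicExtension hp).ι n = n • normElt := rfl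

theorem cyclicExtension_d₁ (hp : Odd p) (f : CyclicRing p) :
    (cyclicExtension hp).d₁ f = skew p * f := LinearMap.mulLeft_apply ..

theorem cyclicExtension_d₂ (hp : Odd p) (f : CyclicRing p) :
    (cyclicExtension hp).d₂ f = normElt * f := LinearMap.mulLeft_apply ..

theorem cyclicExtension_d₃ (hp : Odd p) (f : CyclicRing p) :
    (cyclicExtension hp).d₃ f = skew p * f := LinearMap.mulLeft_apply ..

noncomputable instance : Fintype (Q16p p) :=
  Fintype.ofEquiv _ SemidirectProduct.equivProd.symm

theorem sum_eq {A : Type*} [AddCommMonoid A] (F : Q16p p → A) :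
    ∑ g, F g = ∑ q, ∑ c : ZMod p, F ⟨.ofAdd c, q⟩ := by
  rw [← Equiv.sum_comp SemidirectProduct.equivProd.symm, Fintype.sum_prod_type_right]
  exact Finset.sum_congr rfl fun q _ =>
    Fintype.sum_equiv Multiplicative.toAdd _ _ fun _ => rfl

/-- `ℤ[C_p]` is the permutation module on `G/Q₁₆`. With `h` the projection to the line of the base
point, the translates by `C_p` add up to the identity for each `q ∈ Q₁₆`, and there are 16 such `q`.
-/
theorem traceEq_cyclicRep : TraceEq (cyclicRep p) 16 := by
  refine ⟨LinearMap.toSpanSingleton ℤ _ 1 ∘ₗ coeffAt 0, fun f => ?_⟩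
  simp only [LinearMap.comp_apply, LinearMap.toSpanSingleton_apply]
  induction f using induction_X with
  | zero => simp
  | add f g hf hg => simp only [map_add, add_smul, Finset.sum_add_distrib, hf, hg, smul_add]
  | smul c i =>
    simp only [map_zsmul, smul_assoc, ← Finset.smul_sum]
    rw [smul_comm (16 : ℤ) c]
    congr 1
    have (q : QuaternionGroup 4) : ∑ c : ZMod p, coeffAt 0 (cyclicRep p ⟨.ofAdd c, q⟩ (X i)) •
        cyclicRep p (⟨.ofAdd c, q⟩ : Q16p p)⁻¹ 1 = X i := by
      have hu := unit_mul_self (p := p) (Q16.sign q)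
      have hs (c : ZMod p) : sgn (⟨.ofAdd c, q⟩ : Q16p p) = Q16.sign q := rfl
      have hs' (c : ZMod p) : shift (⟨.ofAdd c, q⟩ : Q16p p) = c := rfl
      -- Only the translation that carries `q · i` to `0` contributes.
      rw [Finset.sum_eq_single (-(((Q16.sign q : ℤ) : ZMod p) * i))]
      · rw [cyclicRep_apply, cyclicRep_apply, scale_X, ← X_add, coeffAt_X, shift_inv]
        simp only [hs, hs']
        rw [if_pos (by ring), map_one, mul_one, one_smul]
        congr 1
        linear_combination i * hu
      · intro c _ hc
        rw [cyclicRep_apply, scale_X, ← X_add, coeffAt_X, if_neg, zero_smul]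
        simp only [hs, hs']
        exact fun h => hc (by linear_combination h)
      · simp
    rw [sum_eq, Finset.sum_congr rfl fun q _ => this q, Finset.sum_const, Finset.card_univ,
      QuaternionGroup.card]
    rfl

theorem traceEq_signedRep : TraceEq (signedRep p) 16 := by
  obtain ⟨h, hh⟩ := traceEq_cyclicRep (p := p)
  refine ⟨h, fun f => ?_⟩
  rw [← hh]
  refine Finset.sum_congr rfl fun g _ => ?_
  rw [signedRep_apply, signedRep_apply, map_zsmul, map_zsmul, smul_smul, sgn_inv,
    Int.units_coe_mul_self, one_smul]

theorem exists_cyclic_class (hp : Odd p) : ∃ κ : integralCohomology (Q16p p) 4,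
    (∀ u, ∃ n : ℤ, (16 : ℤ) ^ 4 • u = n • κ) ∧ (∀ n : ℤ, n • κ = 0 ↔ (p : ℤ) ∣ n) ∧
      ∀ θ r, (cyclicExtension hp).HasDegree θ r → r • cohomologyPullback θ 4 κ = κ := by
  refine (cyclicExtension hp).exists_characteristic_class ?_ traceEq_cyclicRep traceEq_signedRep
    traceEq_signedRep traceEq_cyclicRep ⟨normElt, fun g => ?_, aug_normElt⟩ fun a ha => ?_
  · have : Nat.Coprime (2 ^ 4) p := hp.coprime_two_left.pow_left 4
    exact_mod_cast Nat.isCoprime_iff_coprime.2 this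
  · rw [cyclicRep_apply, scale_normElt (isUnit_sign _), X_mul_normElt]
  · have h := ha (SemidirectProduct.inl (.ofAdd 1))
    rw [cyclicRep_apply] at h
    have h₁ : shift (SemidirectProduct.inl (.ofAdd 1) : Q16p p) = 1 := rfl
    have h₂ : sgn (SemidirectProduct.inl (.ofAdd 1) : Q16p p) = 1 := map_one Q16.sign
    rw [h₁, h₂, Units.val_one, Int.cast_one, scale_one] at h
    obtain ⟨b, rfl⟩ := exists_of_mul_eq_zero (f := a) (by rw [sub_one_mul, h, sub_self])
    refine ⟨b, ?_⟩
    change aug (b • normElt) = _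
    rw [map_zsmul, aug_normElt, smul_eq_mul, mul_comm]

/-- `Q = (zᵏ - z⁻ᵏ)/(z - z⁻¹)`, built by the recursion `Q_{k+1} = Q_k z + z⁻ᵏ`. It is symmetric
under inversion because numerator and denominator are both odd. -/
theorem exists_skew_quotient (hp : Odd p) (k : ℕ) : ∃ Q : CyclicRing p,
    scale (k : ZMod p) (skew p) = Q * skew p ∧ aug Q = k ∧
      ∀ u : ℤˣ, scale ((u : ℤ) : ZMod p) Q = Q := by
  have key : ∃ Q : CyclicRing p, scale (k : ZMod p) (skew p) = Q * skew p ∧ aug Q = k := by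
    induction k with
    | zero => exact ⟨0, by simp [skew], by simp⟩
    | succ k ih =>
      obtain ⟨Q, hQ, hQ'⟩ := ih
      refine ⟨Q * X 1 + X (-(k : ZMod p)), ?_, by simp [hQ']⟩
      simp only [skew, map_sub, scale_X, mul_one, mul_neg, Nat.cast_succ, neg_add, X_add] at hQ ⊢
      linear_combination X 1 * hQ
  obtain ⟨Q, hQ, hQ'⟩ := key
  refine ⟨Q, hQ, hQ', fun u => ?_⟩
  have h := congrArg (scale ((u : ℤ) : ZMod p)) hQ
  rw [scale_scale, mul_comm, ← scale_scale, map_mul, scale_skew, map_zsmul, hQ] at h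
  have h' : skew p * (scale ((u : ℤ) : ZMod p) Q - Q) = 0 := by
    have hu : ((u : ℤ) : CyclicRing p) * ((u : ℤ) : CyclicRing p) = 1 := by
      rw [← Int.cast_mul, Int.units_coe_mul_self, Int.cast_one]
    simp only [zsmul_eq_mul] at h
    linear_combination (-(((u : ℤ) : CyclicRing p))) * h -
      (skew p * (scale ((u : ℤ) : ZMod p) Q - Q)) * hu
  -- Cancelling the skew element leaves an ambiguity by a multiple of the norm; equality of
  -- augmentations excludes it.
  obtain ⟨a, ha⟩ := exists_of_skew_mul_eq_zero hp h'
  have h₀ := congrArg aug ha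
  rw [map_sub, aug_scale, sub_self, map_zsmul, aug_normElt, smul_eq_mul, eq_comm,
    mul_eq_zero_iff_right (by exact_mod_cast NeZero.ne p)] at h₀
  rwa [h₀, zero_smul, sub_eq_zero] at ha

/-- The substitution `z ↦ zᵏ` undoes the power `a`, and translation by `-kW` absorbs the coboundary
`W - sgn(g)W`. The substitution multiplies `z - z⁻¹` by `Q` and fixes the norm, so the correcting
factors in degrees 0 to 3 are `1, Q, Q, Q²`. On the norm, `Q²` acts as its augmentation `k²`. -/
theorem cyclicExtension_hasDegree (hp : Odd p) {θ : Q16p p →* Q16p p} {a W : ZMod p} {k : ℕ}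
    (hk : (k : ZMod p) * a = 1) (hθ : ∀ g, shift (θ g) = a * shift g + W - ((sgn g : ℤ) : ZMod p) * W)
    (hs : ∀ g, sgn (θ g) = sgn g) : (cyclicExtension hp).HasDegree θ (k ^ 2) := by
  obtain ⟨Q, hQ, hQk, hQu⟩ := exists_skew_quotient hp k
  let T (F : CyclicRing p) : CyclicRing p →ₗ[ℤ] CyclicRing p :=
    LinearMap.mulLeft ℤ (X (-((k : ZMod p) * W)) * F) ∘ₗ
      (scale (k : ZMod p)).toAddMonoidHom.toIntLinearMap
  have hT (F f) : T F f = X (-((k : ZMod p) * W)) * F * scale (k : ZMod p) f := rfl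
  have hTe {F : CyclicRing p} (hF : ∀ u : ℤˣ, scale ((u : ℤ) : ZMod p) F = F) (g : Q16p p)
      (f : CyclicRing p) : T F (cyclicRep p (θ g) f) = cyclicRep p g (T F f) := by
    rw [hT, hT, cyclicRep_apply, cyclicRep_apply, map_mul, map_mul, map_mul, hF, scale_X, scale_X,
      scale_scale, scale_scale, hs, hθ, mul_comm (k : ZMod p) ((sgn g : ℤ) : ZMod p)]
    have : X (-((k : ZMod p) * W)) * X ((k : ZMod p) * (a * shift g + W - ((sgn g : ℤ) : ZMod p) * W)) =
        X (shift g) * X (((sgn g : ℤ) : ZMod p) * -((k : ZMod p) * W)) := by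
      rw [← X_add, ← X_add]
      congr 1
      linear_combination shift g * hk
    linear_combination F * scale (((sgn g : ℤ) : ZMod p) * (k : ZMod p)) f * this
  have hTe' {F : CyclicRing p} (hF : ∀ u : ℤˣ, scale ((u : ℤ) : ZMod p) F = F) (g : Q16p p)
      (f : CyclicRing p) : T F (signedRep p (θ g) f) = signedRep p g (T F f) := by
    rw [signedRep_apply, signedRep_apply, map_zsmul, hTe hF, hs]
  have hku : IsUnit (k : ZMod p) := IsUnit.of_mul_eq_one _ hk
  refine ⟨T 1, T Q, T Q, T (Q ^ 2), hTe (by simp), hTe' hQu, hTe' hQu, hTe (by simp [hQu]),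
    fun f => ?_, fun f => ?_, fun f => ?_, fun f => ?_, fun n => ?_⟩
  · change aug (T 1 f) = aug f
    simp [hT]
  · rw [cyclicExtension_d₁, cyclicExtension_d₁, hT, hT, map_mul, hQ]
    ring
  · rw [cyclicExtension_d₂, cyclicExtension_d₂, hT, hT, map_mul, scale_normElt hku]
    ring
  · rw [cyclicExtension_d₃, cyclicExtension_d₃, hT, hT, map_mul, hQ]
    ring
  · rw [cyclicExtension_ι, cyclicExtension_ι]
    have h₁ : T (Q ^ 2) (n • normElt) = n • T (Q ^ 2) normElt := map_zsmul _ _ _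
    have h₂ : T (Q ^ 2) normElt = ((k : ℤ) ^ 2) • normElt := by
      rw [hT, scale_normElt hku, mul_normElt, map_mul, map_pow, aug_X, one_mul, hQk]
    rw [h₁, h₂, smul_smul, mul_comm n]

end Q16p

/-! ### The periodic resolution of `Q₁₆` -/

namespace Quat

open CyclicRing

/-- The integral group ring of the subgroup of `Q₁₆` generated by `x`. -/
abbrev R : Type := CyclicRing (2 * 4)

/-- The generator `x`. -/
noncomputable def x : R := X 1

theorem X_eq_pow (k : ℕ) {i : ZMod (2 * 4)} (h : (k : ZMod (2 * 4)) = i) : X i = x ^ k := by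
  rw [← h, X_natCast, x]

theorem x_pow_eight : x ^ 8 = 1 := by
  rw [← X_eq_pow 8 (i := 0) (by decide), X_zero]

/-- The involution `x ↦ x⁻¹` of the group ring. -/
noncomputable abbrev bar : R →+* R := scale (-1)

theorem bar_x : bar x = x ^ 7 := by
  rw [x, scale_X, X_eq_pow 7 (by decide), x]

theorem bar_bar (a : R) : bar (bar a) = a := by simp

theorem normElt_eq : (normElt : R) = 1 + x + x ^ 2 + x ^ 3 + x ^ 4 + x ^ 5 + x ^ 6 + x ^ 7 := by
  have : (Finset.univ : Finset (ZMod (2 * 4))) = {0, 1, 2, 3, 4, 5, 6, 7} := by decide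
  rw [normElt, this]
  repeat rw [Finset.sum_insert (by decide)]
  rw [Finset.sum_singleton, X_zero, X_eq_pow 1 (by decide), X_eq_pow 2 (by decide),
    X_eq_pow 3 (by decide), X_eq_pow 4 (by decide), X_eq_pow 5 (by decide),
    X_eq_pow 6 (by decide), X_eq_pow 7 (by decide)]
  ring

/-- The left regular representation of `Q₁₆`, on `ℤ[Q₁₆] = R ⊕ R y`. -/
noncomputable def rep : Representation ℤ (QuaternionGroup 4) (R × R) where
  toFun
    | .a i => (LinearMap.mulLeft ℤ (X i)).prodMap (LinearMap.mulLeft ℤ (X i))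
    | .xa i => ((LinearMap.mulLeft ℤ (X (4 - i)) ∘ₗ bar.toAddMonoidHom.toIntLinearMap).prodMap
        (LinearMap.mulLeft ℤ (X (-i)) ∘ₗ bar.toAddMonoidHom.toIntLinearMap)) ∘ₗ
          (LinearEquiv.prodComm ℤ R R).toLinearMap
  map_one' := by
    refine LinearMap.ext fun f => ?_
    change (X 0 * f.1, X 0 * f.2) = f
    simp
  map_mul' := by
    have h8 : (4 + 4 : ZMod (2 * 4)) = 0 := by decide
    rintro (i | i) (j | j) <;> refine LinearMap.ext fun f => ?_
    · change (X (i + j) * f.1, X (i + j) * f.2) = (X i * (X j * f.1), X i * (X j * f.2))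
      simp only [X_add, mul_assoc]
    · change (X (4 - (j - i)) * bar f.2, X (-(j - i)) * bar f.1) =
        (X i * (X (4 - j) * bar f.2), X i * (X (-j) * bar f.1))
      rw [← mul_assoc, ← mul_assoc, ← X_add, ← X_add]
      congr 3 <;> ring_nf
    · change (X (4 - (i + j)) * bar f.2, X (-(i + j)) * bar f.1) =
        (X (4 - i) * bar (X j * f.2), X (-i) * bar (X j * f.1))
      simp only [map_mul, scale_X]
      rw [← mul_assoc, ← mul_assoc, ← X_add, ← X_add]
      congr 3 <;> ring_nf
    · change (X (((4 : ℕ) : ZMod (2 * 4)) + j - i) * f.1, X (((4 : ℕ) : ZMod (2 * 4)) + j - i) * f.2) =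
        (X (4 - i) * bar (X (-j) * bar f.1), X (-i) * bar (X (4 - j) * bar f.2))
      simp only [map_mul, scale_X, bar_bar]
      rw [← mul_assoc, ← mul_assoc, ← X_add, ← X_add]
      have e₁ : ((4 : ℕ) : ZMod (2 * 4)) + j - i = 4 - i + -1 * -j := by push_cast; ring
      have e₂ : ((4 : ℕ) : ZMod (2 * 4)) + j - i = -i + -1 * (4 - j) := by
        push_cast; linear_combination h8
      rw [← e₁, ← e₂]

theorem rep_a (i : ZMod (2 * 4)) (f : R × R) :
    rep (.a i) f = (X i * f.1, X i * f.2) := rfl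

theorem rep_xa (i : ZMod (2 * 4)) (f : R × R) :
    rep (.xa i) f = (X (4 - i) * bar f.2, X (-i) * bar f.1) := rfl

/-- Right multiplication by `c + d y` on `ℤ[Q₁₆] = R ⊕ R y`. -/
noncomputable def rmul (c d : R) : R × R →ₗ[ℤ] R × R where
  toFun f := (f.1 * c + f.2 * (bar d * x ^ 4), f.1 * d + f.2 * bar c)
  map_add' f g := by ext1 <;> simp <;> ring
  map_smul' n f := by ext1 <;> simp <;> ring

theorem rmul_apply (c d : R) (f : R × R) :
    rmul c d f = (f.1 * c + f.2 * (bar d * x ^ 4), f.1 * d + f.2 * bar c) := rfl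

theorem rmul_rep (c d : R) (g : QuaternionGroup 4) (f : R × R) :
    rmul c d (rep g f) = rep g (rmul c d f) := by
  have h4 : bar (x ^ 4) = x ^ 4 := by
    rw [map_pow, bar_x]
    linear_combination (x ^ 20 + x ^ 12 + x ^ 4) * x_pow_eight
  rcases g with i | i
  · rw [rep_a, rep_a, rmul_apply, rmul_apply]
    ext1 <;> ring
  · have : X (4 - i) = x ^ 4 * X (-i) := by
      rw [← X_eq_pow 4 (i := 4) (by decide), ← X_add, sub_eq_add_neg]
    rw [rep_xa, rep_xa, rmul_apply, rmul_apply, this]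
    simp only [map_add, map_mul, bar_bar, h4]
    ext1 <;> ring

/-- The element `1 + x + x² + x³`. -/
noncomputable def N₄ : R := 1 + x + x ^ 2 + x ^ 3

/-- The first differential of the periodic resolution of `Q₁₆`. -/
noncomputable def d₁ : (R × R) × (R × R) →ₗ[ℤ] R × R :=
  (rmul (x - 1) 0).coprod (rmul (-1) 1)

/-- The second differential of the periodic resolution of `Q₁₆`. -/
noncomputable def d₂ : (R × R) × (R × R) →ₗ[ℤ] (R × R) × (R × R) :=
  ((rmul N₄ 0).coprod (rmul 1 x)).prod ((rmul (-1) (-1)).coprod (rmul (x - 1) 0))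

/-- The third differential of the periodic resolution of `Q₁₆`. -/
noncomputable def d₃ : R × R →ₗ[ℤ] (R × R) × (R × R) :=
  (rmul (x - 1) 0).prod (rmul 1 (-x))

theorem d₁_apply (u v : R × R) : d₁ (u, v) =
    (u.1 * (x - 1) - v.1 + v.2 * x ^ 4, u.2 * (x ^ 7 - 1) + v.1 - v.2) := by
  change rmul _ _ u + rmul _ _ v = _
  simp only [rmul_apply, map_sub, map_neg, map_one, map_zero, bar_x]
  ext1 <;> simp <;> ring

/-- The coefficients of `r` and `s` are the Fox derivatives of the relators `x⁴y⁻²` and `xyxy⁻¹`,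
namely `(1+x+x²+x³, -1-y)` and `(1+xy, x-1)`. -/
theorem d₂_apply (r s : R × R) : d₂ (r, s) =
    ((r.1 * (1 + x + x ^ 2 + x ^ 3) + s.1 + s.2 * x ^ 3,
      r.2 * (1 + x ^ 7 + x ^ 6 + x ^ 5) + s.1 * x + s.2),
      (-r.1 - r.2 * x ^ 4 + s.1 * (x - 1), -r.1 - r.2 + s.2 * (x ^ 7 - 1))) := by
  change (rmul _ _ r + rmul _ _ s, rmul _ _ r + rmul _ _ s) = _
  simp only [rmul_apply, map_sub, map_neg, map_one, map_zero, map_add, map_pow, bar_x, N₄]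
  have := x_pow_eight
  refine Prod.ext (Prod.ext ?_ ?_) (Prod.ext ?_ ?_) <;> simp <;> grind

theorem d₃_apply (e : R × R) : d₃ e =
    ((e.1 * (x - 1), e.2 * (x ^ 7 - 1)), (e.1 - e.2 * x ^ 3, e.2 - e.1 * x)) := by
  change (rmul _ _ e, rmul _ _ e) = _
  simp only [rmul_apply, map_sub, map_neg, map_one, map_zero, bar_x]
  have := x_pow_eight
  ext1 <;> ext1 <;> simp <;> grind

theorem exists_of_mul_eq_zero' {f : R} (hf : f * (x ^ 7 - 1) = 0) : ∃ a : ℤ, f = a • normElt := by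
  refine exists_of_mul_eq_zero ?_
  change (x - 1) * f = 0
  have := x_pow_eight
  linear_combination (-x) * hf + f * this

theorem exact₀ (f : R × R) : aug f.1 + aug f.2 = 0 ↔ ∃ e, d₁ e = f := by
  constructor
  · intro h
    rw [← map_add] at h
    obtain ⟨g, hg⟩ := exists_of_aug_eq_zero h
    -- Modulo multiples of `y - 1`, the element `f.1 + f.2 y` becomes `f.1 + f.2`, which has
    -- augmentation zero in `R`.
    refine ⟨((g, 0), (f.2, 0)), ?_⟩
    rw [d₁_apply]
    ext1
    · change (f.1 + f.2 = (x - 1) * g) at hg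
      linear_combination -hg
    · ring
  · rintro ⟨⟨u, v⟩, rfl⟩
    rw [d₁_apply]
    simp [x]

theorem exact₁ (f : (R × R) × (R × R)) : d₁ f = 0 ↔ ∃ e, d₂ e = f := by
  have hx := x_pow_eight
  constructor
  · intro h
    obtain ⟨⟨a, b⟩, ⟨c, d⟩⟩ := f
    rw [d₁_apply, Prod.mk_eq_zero] at h
    obtain ⟨h₁, h₂⟩ := h
    dsimp only at h₁ h₂
    -- The sum of the two equations eliminates `c`, leaving an element killed by `x - 1`.
    obtain ⟨n, hn⟩ := exists_of_mul_eq_zero (n := 2 * 4)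
      (f := a + d * (1 + x + x ^ 2 + x ^ 3) - b * x ^ 7) (by
        change (x - 1) * _ = 0
        linear_combination h₁ + h₂ - b * hx)
    rw [normElt_eq, zsmul_eq_mul] at hn
    generalize (n : R) = m at hn
    obtain rfl : c = d - b * (x ^ 7 - 1) := by linear_combination h₂
    obtain rfl : a = m * (1 + x + x ^ 2 + x ^ 3 + x ^ 4 + x ^ 5 + x ^ 6 + x ^ 7) -
      d * (1 + x + x ^ 2 + x ^ 3) + b * x ^ 7 := by linear_combination hn
    clear h₁ h₂ hn
    -- The entries `-d` and `b x⁷` account for `d` and `b`. The terms in `m` produce the norm, split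
    -- as `(1 + x⁴)(1 + x + x² + x³)`.
    refine ⟨((m - d, -m * x ^ 4), (b * x ^ 7, m * x ^ 4 * (1 + x ^ 7 + x ^ 6 + x ^ 5))), ?_⟩
    rw [d₂_apply]
    refine Prod.ext (Prod.ext ?_ ?_) (Prod.ext ?_ ?_) <;> dsimp only <;> grind
  · rintro ⟨⟨r, s⟩, rfl⟩
    rw [d₂_apply, d₁_apply]
    ext1 <;> simp only [Prod.fst_zero, Prod.snd_zero] <;> grind

theorem exact₂ (f : (R × R) × (R × R)) : d₂ f = 0 ↔ ∃ e, d₃ e = f := by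
  have hx := x_pow_eight
  constructor
  · intro h
    obtain ⟨⟨a, b⟩, ⟨c, d⟩⟩ := f
    rw [d₂_apply, Prod.mk_eq_zero, Prod.mk_eq_zero, Prod.mk_eq_zero] at h
    obtain ⟨⟨h₁, h₂⟩, h₃, h₄⟩ := h
    dsimp only at h₁ h₂ h₃ h₄
    obtain rfl : d = -b * (1 + x ^ 7 + x ^ 6 + x ^ 5) - c * x := by linear_combination h₂
    obtain rfl : a = c * (x - 1) - b * x ^ 4 := by linear_combination -h₃
    -- After elimination of `a` and `d`, all that is left of `h₁` is `-b` times the norm; so `b` has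
    -- augmentation zero.
    have hb : b * normElt = 0 := by
      rw [normElt_eq, ← mul_zero (-x ^ 4), ← h₁]
      clear h₁ h₂ h₃ h₄
      grind
    rw [mul_normElt] at hb
    obtain ⟨g, hg⟩ := exists_of_aug_eq_zero (smul_normElt_injective (hb.trans (zero_smul ℤ _).symm))
    clear h₁ h₂ h₃ h₄ hb
    obtain rfl : b = (x - 1) * g := hg
    refine ⟨(c - x * g * x ^ 3, -x * g), ?_⟩
    rw [d₃_apply]
    refine Prod.ext (Prod.ext ?_ ?_) (Prod.ext ?_ ?_) <;> dsimp only <;> grind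
  · rintro ⟨e, rfl⟩
    rw [d₃_apply, d₂_apply]
    refine Prod.ext (Prod.ext ?_ ?_) (Prod.ext ?_ ?_) <;>
      simp only [Prod.fst_zero, Prod.snd_zero] <;> grind

theorem exact₃ (f : R × R) : d₃ f = 0 ↔ ∃ n : ℤ, n • ((normElt, normElt) : R × R) = f := by
  have hx := x_pow_eight
  constructor
  · intro h
    obtain ⟨a, b⟩ := f
    rw [d₃_apply, Prod.mk_eq_zero, Prod.mk_eq_zero, Prod.mk_eq_zero] at h
    obtain ⟨⟨h₁, h₂⟩, h₃, h₄⟩ := h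
    dsimp only at h₁ h₂ h₃ h₄
    obtain ⟨n, rfl⟩ := exists_of_mul_eq_zero' h₂
    refine ⟨n, Prod.ext ?_ rfl⟩
    have : (normElt : R) * x ^ 3 = normElt := by
      rw [← X_eq_pow 3 (i := 3) rfl]
      exact (mul_comm _ _).trans (X_mul_normElt _)
    rw [smul_mul_assoc, this, sub_eq_zero] at h₃
    exact h₃.symm
  · rintro ⟨n, rfl⟩
    rw [map_zsmul, d₃_apply, normElt_eq]
    have : ∀ z : (R × R) × (R × R), z = 0 → n • z = 0 := by rintro _ rfl; simp
    apply this
    refine Prod.ext (Prod.ext ?_ ?_) (Prod.ext ?_ ?_) <;>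
      simp only [Prod.fst_zero, Prod.snd_zero] <;> grind

end Quat

/-! ### Products, inflation and conjugation -/

section General

variable {G H M N : Type} [Group G] [Group H] [AddCommGroup M] [AddCommGroup N]

theorem TraceEq.prod [Fintype G] {ρ : Representation ℤ G M} {τ : Representation ℤ G N} {m : ℤ}
    (hρ : TraceEq ρ m) (hτ : TraceEq τ m) : TraceEq (ρ.prod τ) m := by
  obtain ⟨h, hh⟩ := hρ
  obtain ⟨k, hk⟩ := hτ
  refine ⟨h.prodMap k, fun a => ?_⟩
  refine Prod.ext ?_ ?_
  · rw [Prod.fst_sum]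
    exact hh a.1
  · rw [Prod.snd_sum]
    exact hk a.2

variable {M₀ M₁ M₂ M₃ : Type} [AddCommGroup M₀] [AddCommGroup M₁]
    [AddCommGroup M₂] [AddCommGroup M₃] {ρ₀ : Representation ℤ G M₀} {ρ₁ : Representation ℤ G M₁}
    {ρ₂ : Representation ℤ G M₂} {ρ₃ : Representation ℤ G M₃}

namespace FourExtension

/-- The pullback of an extension along a group homomorphism. -/
def inflate (E : FourExtension ρ₀ ρ₁ ρ₂ ρ₃) (π : H →* G) :
    FourExtension (ρ₀.comp π) (ρ₁.comp π) (ρ₂.comp π) (ρ₃.comp π) where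
  __ := E
  ε_equivariant g := E.ε_equivariant (π g)
  d₁_equivariant g := E.d₁_equivariant (π g)
  d₂_equivariant g := E.d₂_equivariant (π g)
  d₃_equivariant g := E.d₃_equivariant (π g)
  ι_equivariant g := E.ι_equivariant (π g)

theorem HasDegree.inflate {E : FourExtension ρ₀ ρ₁ ρ₂ ρ₃} {η : G →* G} {r : ℤ}
    (h : E.HasDegree η r) (π : H →* G) {θ : H →* H} (hθ : ∀ g, π (θ g) = η (π g)) :
    (E.inflate π).HasDegree θ r := by
  obtain ⟨T₀, T₁, T₂, T₃, h₀, h₁, h₂, h₃, h⟩ := h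
  refine ⟨T₀, T₁, T₂, T₃, fun g a => ?_, fun g a => ?_, fun g a => ?_, fun g a => ?_, h⟩
  · simpa [hθ] using h₀ (π g) a
  · simpa [hθ] using h₁ (π g) a
  · simpa [hθ] using h₂ (π g) a
  · simpa [hθ] using h₃ (π g) a

/-- The action of `q⁻¹` on every term is semilinear along conjugation by `q`, commutes with the
differentials, and is trivial on both copies of `ℤ`. -/
theorem hasDegree_conj (E : FourExtension ρ₀ ρ₁ ρ₂ ρ₃) (q : G) :
    E.HasDegree (MulAut.conj q).toMonoidHom 1 := by
  have key {M : Type} [AddCommGroup M] (ρ : Representation ℤ G M) (g : G) (a : M) :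
      ρ q⁻¹ (ρ ((MulAut.conj q).toMonoidHom g) a) = ρ g (ρ q⁻¹ a) := by
    rw [← Module.End.mul_apply, ← Module.End.mul_apply, ← map_mul, ← map_mul]
    congr 2
    simp [mul_assoc]
  refine ⟨ρ₀ q⁻¹, ρ₁ q⁻¹, ρ₂ q⁻¹, ρ₃ q⁻¹, key ρ₀, key ρ₁, key ρ₂, key ρ₃,
    fun a => E.ε_equivariant _ a, fun a => (E.d₁_equivariant _ a).symm,
    fun a => (E.d₂_equivariant _ a).symm, fun a => (E.d₃_equivariant _ a).symm, fun n => ?_⟩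
  rw [← E.ι_equivariant, one_mul]

end FourExtension

end General

/-! ### Degrees of the automorphisms of `Q₁₆` -/

namespace Quat

open CyclicRing

/-- The four-term extension coming from the periodic resolution of `Q₁₆`. -/
noncomputable def extension : FourExtension rep (rep.prod rep) (rep.prod rep) rep where
  ε := aug.toAddMonoidHom.toIntLinearMap.coprod aug.toAddMonoidHom.toIntLinearMap
  d₁ := d₁
  d₂ := d₂
  d₃ := d₃
  ι := LinearMap.toSpanSingleton ℤ _ (normElt, normElt)
  ε_equivariant g a := by
    change aug _ + aug _ = aug _ + aug _
    rcases g with i | i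
    · simp [rep_a]
    · simp [rep_xa, add_comm]
  d₁_equivariant g a := by
    change rmul _ _ (rep g a.1) + rmul _ _ (rep g a.2) = rep g (rmul _ _ a.1 + rmul _ _ a.2)
    rw [rmul_rep, rmul_rep, map_add]
  d₂_equivariant g a := by
    change (rmul _ _ (rep g a.1) + rmul _ _ (rep g a.2),
      rmul _ _ (rep g a.1) + rmul _ _ (rep g a.2)) =
      (rep g (rmul _ _ a.1 + rmul _ _ a.2), rep g (rmul _ _ a.1 + rmul _ _ a.2))
    simp only [rmul_rep, map_add]
  d₃_equivariant g a := by
    change (rmul _ _ (rep g a), rmul _ _ (rep g a)) = (rep g (rmul _ _ a), rep g (rmul _ _ a))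
    simp only [rmul_rep]
  ι_equivariant g n := by
    rw [LinearMap.toSpanSingleton_apply, map_zsmul]
    congr 1
    rcases g with i | i
    · rw [rep_a, X_mul_normElt]
    · rw [rep_xa, scale_normElt (by decide), X_mul_normElt, X_mul_normElt]
  ε_surjective n := ⟨(n, 0), by simp⟩
  exact₀ := exact₀
  exact₁ := exact₁
  exact₂ := exact₂
  exact₃ := exact₃
  ι_injective _ _ h := smul_normElt_injective (congrArg Prod.fst h)

theorem sum_quaternionGroup {A : Type*} [AddCommMonoid A] (F : QuaternionGroup 4 → A) :
    ∑ q, F q = ∑ i, F (.a i) + ∑ i, F (.xa i) := by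
  let e : ZMod (2 * 4) ⊕ ZMod (2 * 4) ≃ QuaternionGroup 4 :=
    { toFun := Sum.elim .a .xa
      invFun
        | .a i => .inl i
        | .xa i => .inr i
      left_inv := by rintro (i | i) <;> rfl
      right_inv := by rintro (i | i) <;> rfl }
  rw [← Equiv.sum_comp e, Fintype.sum_sum_type]
  rfl

theorem coeffAt_bar (i : ZMod (2 * 4)) (f : R) : coeffAt i (bar f) = coeffAt (-i) f := by
  induction f using induction_X with
  | zero => simp
  | add f g hf hg => simp only [map_add, hf, hg]
  | smul c j => simp only [map_zsmul, scale_X, coeffAt_X, neg_mul, one_mul, neg_eq_iff_eq_neg]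

/-- The projection of `ℤ[Q₁₆]` onto the summand spanned by the identity. -/
noncomputable def unitPart : R × R →ₗ[ℤ] R × R where
  toFun f := (coeffAt 0 f.1 • 1, 0)
  map_add' f g := by simp
  map_smul' n f := by
    refine Prod.ext ?_ (smul_zero n).symm
    change coeffAt 0 (n • f.1) • (1 : R) = n • coeffAt 0 f.1 • (1 : R)
    rw [map_zsmul, smul_assoc]

theorem unitPart_apply (f : R × R) : unitPart f = (coeffAt 0 f.1 • 1, 0) := rfl

/-- The module is free of rank one: the translates of the projection to the coefficient of the
identity sum to the identity map. -/
theorem traceEq_rep : TraceEq rep 1 := by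
  refine ⟨unitPart, fun f => ?_⟩
  rw [sum_quaternionGroup, one_smul]
  have h₁ (i : ZMod (2 * 4)) : rep (.a i)⁻¹ (unitPart (rep (.a i) f)) =
      (coeffAt (-i) f.1 • X (-i), 0) := by
    have : (QuaternionGroup.a i : QuaternionGroup 4)⁻¹ = .a (-i) := rfl
    rw [this, rep_a, rep_a, unitPart_apply]
    dsimp only
    rw [coeffAt_X_mul, zero_sub, mul_zero, mul_smul_comm, mul_one]
  have h₂ (i : ZMod (2 * 4)) : rep (.xa i)⁻¹ (unitPart (rep (.xa i) f)) =
      (0, coeffAt (4 - i) f.2 • X (4 - i)) := by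
    have : (QuaternionGroup.xa i : QuaternionGroup 4)⁻¹ = .xa (4 + i) := rfl
    rw [this, rep_xa, rep_xa, unitPart_apply]
    dsimp only
    have h8 : -(4 + i : ZMod (2 * 4)) = 4 - i := by revert i; decide
    rw [coeffAt_X_mul, zero_sub, coeffAt_bar, neg_neg, map_zero, mul_zero, map_zsmul, map_one,
      mul_smul_comm, mul_one, h8]
  simp only [h₁, h₂]
  refine Prod.ext ?_ ?_
  · simpa [Prod.fst_sum] using (Equiv.sum_comp (Equiv.neg (ZMod (2 * 4))) fun i => coeffAt i f.1 • X i).trans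
      (sum_coeffAt f.1)
  · simpa [Prod.snd_sum] using (Equiv.sum_comp (Equiv.subLeft (4 : ZMod (2 * 4))) fun i =>
      coeffAt i f.2 • X i).trans (sum_coeffAt f.2)

/-- The automorphism `x ↦ x³`, `y ↦ y` of `Q₁₆`. -/
def cube : MulAut (QuaternionGroup 4) where
  toFun
    | .a i => .a (3 * i)
    | .xa i => .xa (3 * i)
  invFun
    | .a i => .a (3 * i)
    | .xa i => .xa (3 * i)
  left_inv := by rintro (i | i) <;> revert i <;> decide
  right_inv := by rintro (i | i) <;> revert i <;> decide
  map_mul' := by rintro (i | i) (j | j) <;> revert i j <;> decide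

/-- The endomorphism of `R` with `x ↦ x³`. -/
noncomputable abbrev scale₃ : R →+* R := scale 3

theorem scale₃_x : scale₃ x = x ^ 3 := by
  rw [x, scale_X, X_eq_pow 3 (by decide), x]

/-- The endomorphism of `ℤ[Q₁₆]` induced by `cube`, followed by right multiplication. -/
noncomputable def cubeMul (c d : R) : R × R →ₗ[ℤ] R × R :=
  rmul c d ∘ₗ scale₃.toAddMonoidHom.toIntLinearMap.prodMap scale₃.toAddMonoidHom.toIntLinearMap

theorem cubeMul_apply (c d : R) (f : R × R) : cubeMul c d f =
    (scale₃ f.1 * c + scale₃ f.2 * (bar d * x ^ 4), scale₃ f.1 * d + scale₃ f.2 * bar c) := rfl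

theorem cubeMul_rep (c d : R) (g : QuaternionGroup 4) (f : R × R) :
    cubeMul c d (rep (cube g) f) = rep g (cubeMul c d f) := by
  have h9 : (3 * 3 : ZMod (2 * 4)) = 1 := by decide
  change rmul c d _ = rep g (rmul c d _)
  rw [← rmul_rep]
  congr 1
  rcases g with i | i
  · change (scale₃ (X (3 * i) * f.1), scale₃ (X (3 * i) * f.2)) =
      (X i * scale₃ f.1, X i * scale₃ f.2)
    rw [map_mul, map_mul, scale_X, ← mul_assoc, h9, one_mul]
  · change (scale₃ (X (4 - 3 * i) * bar f.2), scale₃ (X (-(3 * i)) * bar f.1)) =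
      (X (4 - i) * bar (scale₃ f.2), X (-i) * bar (scale₃ f.1))
    rw [map_mul, map_mul, scale_X, scale_X, scale_scale, scale_scale, scale_scale, scale_scale,
      mul_comm 3 (-1)]
    have e₁ : (3 * (4 - 3 * i) : ZMod (2 * 4)) = 4 - i := by revert i; decide
    have e₂ : (3 * (-(3 * i)) : ZMod (2 * 4)) = -i := by revert i; decide
    rw [e₁, e₂]

/-- The factor comes from `x³ - 1 = (1 + x + x²)(x - 1)`; `y - 1` is fixed by the automorphism. -/
theorem cube_d₁ (u v : R × R) : cubeMul 1 0 (d₁ (u, v)) =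
    d₁ (cubeMul (1 + x + x ^ 2) 0 u, cubeMul 1 0 v) := by
  have hx := x_pow_eight
  rw [d₁_apply, d₁_apply, cubeMul_apply, cubeMul_apply, cubeMul_apply]
  simp only [map_add, map_sub, map_mul, map_one, map_zero, map_pow, scale₃_x, bar_x]
  generalize scale₃ u.1 = a, scale₃ u.2 = b, scale₃ v.1 = c, scale₃ v.2 = d
  refine Prod.ext ?_ ?_ <;> dsimp only <;> grind

/-- With `N₄ = 1+x+x²+x³`, the coefficient `N₄` of `r` turns into `1 + x + … + x¹¹ = 2N₄ + x⁴N₄`.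
The factor `2 - x⁴y` is chosen because `(2 - x⁴y)(1 + y)` differs from `1 + y` by `(1 - x⁴)y`, a
left multiple of `x - 1`, which the second relator can absorb. For `s`, `(1 + x³y)(1 + x + x²) = (1
+ x + x²)(1 + xy)`. -/
theorem cube_d₂_fst (r s : R × R) : cubeMul (1 + x + x ^ 2) 0 (d₂ (r, s)).1 =
    (d₂ (cubeMul 2 (-x ^ 4) r, cubeMul 0 (x ^ 4 * (1 + x ^ 7 + x ^ 6 + x ^ 5)) r +
      cubeMul (1 + x + x ^ 2) 0 s)).1 := by
  have hx := x_pow_eight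
  rw [d₂_apply, d₂_apply]
  simp only [cubeMul_apply, Prod.fst_add, Prod.snd_add]
  simp only [map_add, map_mul, map_one, map_zero, map_pow, map_neg, map_ofNat, scale₃_x, bar_x]
  generalize scale₃ r.1 = a, scale₃ r.2 = b, scale₃ s.1 = c, scale₃ s.2 = d
  refine Prod.ext ?_ ?_ <;> dsimp only <;> grind

theorem cube_d₂_snd (r s : R × R) : cubeMul 1 0 (d₂ (r, s)).2 =
    (d₂ (cubeMul 2 (-x ^ 4) r, cubeMul 0 (x ^ 4 * (1 + x ^ 7 + x ^ 6 + x ^ 5)) r +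
      cubeMul (1 + x + x ^ 2) 0 s)).2 := by
  have hx := x_pow_eight
  rw [d₂_apply, d₂_apply]
  simp only [cubeMul_apply, Prod.fst_add, Prod.snd_add]
  simp only [map_add, map_sub, map_mul, map_one, map_zero, map_pow, map_neg, map_ofNat,
    scale₃_x, bar_x]
  generalize scale₃ r.1 = a, scale₃ r.2 = b, scale₃ s.1 = c, scale₃ s.2 = d
  refine Prod.ext ?_ ?_ <;> dsimp only <;> grind

theorem cube_d₃_fst (e : R × R) : cubeMul 2 (-x ^ 4) (d₃ e).1 =
    (d₃ (cubeMul (2 * (1 + x + x ^ 2)) ((1 + x + x ^ 2) * x ^ 5) e)).1 := by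
  have hx := x_pow_eight
  rw [d₃_apply, d₃_apply]
  simp only [cubeMul_apply]
  simp only [map_add, map_sub, map_mul, map_one, map_pow, map_neg, map_ofNat, scale₃_x, bar_x]
  generalize scale₃ e.1 = a, scale₃ e.2 = b
  refine Prod.ext ?_ ?_ <;> dsimp only <;> grind

theorem cube_d₃_snd (e : R × R) : cubeMul 0 (x ^ 4 * (1 + x ^ 7 + x ^ 6 + x ^ 5)) (d₃ e).1 +
    cubeMul (1 + x + x ^ 2) 0 (d₃ e).2 =
    (d₃ (cubeMul (2 * (1 + x + x ^ 2)) ((1 + x + x ^ 2) * x ^ 5) e)).2 := by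
  have hx := x_pow_eight
  rw [d₃_apply, d₃_apply]
  simp only [cubeMul_apply]
  simp only [map_add, map_sub, map_mul, map_one, map_zero, map_pow, map_ofNat, scale₃_x, bar_x]
  generalize scale₃ e.1 = a, scale₃ e.2 = b
  refine Prod.ext ?_ ?_ <;> simp only [Prod.fst_add, Prod.snd_add] <;> grind

/-- The norm of `Q₁₆` is fixed by the automorphism, and right multiplication scales it by the
augmentation of the factor, here `2·3 + 3 = 9`. -/
theorem cube_normElt : cubeMul (2 * (1 + x + x ^ 2)) ((1 + x + x ^ 2) * x ^ 5) (normElt, normElt) =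
    (9 : ℤ) • (normElt, normElt) := by
  have hx := x_pow_eight
  rw [cubeMul_apply, scale_normElt (by decide)]
  simp only [map_add, map_mul, map_one, map_pow, map_ofNat, bar_x]
  rw [normElt_eq]
  rw [Prod.smul_mk, zsmul_eq_mul]
  refine Prod.ext ?_ ?_ <;> push_cast <;> grind

/-- The semilinear endomorphism covering `cube` in degree one. -/
noncomputable def cubeT₁ : (R × R) × (R × R) →ₗ[ℤ] (R × R) × (R × R) :=
  (cubeMul (1 + x + x ^ 2) 0).prodMap (cubeMul 1 0)

/-- The semilinear endomorphism covering `cube` in degree two. -/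
noncomputable def cubeT₂ : (R × R) × (R × R) →ₗ[ℤ] (R × R) × (R × R) :=
  (cubeMul 2 (-x ^ 4) ∘ₗ LinearMap.fst ℤ _ _).prod
    ((cubeMul 0 (x ^ 4 * (1 + x ^ 7 + x ^ 6 + x ^ 5))).coprod (cubeMul (1 + x + x ^ 2) 0))

/-- The semilinear endomorphism covering `cube` in degree three. -/
noncomputable def cubeT₃ : R × R →ₗ[ℤ] R × R :=
  cubeMul (2 * (1 + x + x ^ 2)) ((1 + x + x ^ 2) * x ^ 5)

theorem cubeT₁_apply (u v : R × R) :
    cubeT₁ (u, v) = (cubeMul (1 + x + x ^ 2) 0 u, cubeMul 1 0 v) := rfl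

theorem cubeT₂_apply (r s : R × R) : cubeT₂ (r, s) = (cubeMul 2 (-x ^ 4) r,
    cubeMul 0 (x ^ 4 * (1 + x ^ 7 + x ^ 6 + x ^ 5)) r + cubeMul (1 + x + x ^ 2) 0 s) := rfl

theorem prodRep_apply (g : QuaternionGroup 4) (u v : R × R) :
    rep.prod rep g (u, v) = (rep g u, rep g v) := rfl

theorem cubeT₁_rep (g : QuaternionGroup 4) (a : (R × R) × (R × R)) :
    cubeT₁ (rep.prod rep (cube g) a) = rep.prod rep g (cubeT₁ a) := by
  obtain ⟨u, v⟩ := a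
  rw [prodRep_apply, cubeT₁_apply, cubeT₁_apply, prodRep_apply, cubeMul_rep, cubeMul_rep]

theorem cubeT₂_rep (g : QuaternionGroup 4) (a : (R × R) × (R × R)) :
    cubeT₂ (rep.prod rep (cube g) a) = rep.prod rep g (cubeT₂ a) := by
  obtain ⟨u, v⟩ := a
  rw [prodRep_apply, cubeT₂_apply, cubeT₂_apply, prodRep_apply, cubeMul_rep, cubeMul_rep,
    cubeMul_rep, map_add]

theorem cubeT₁_d₁ (a : (R × R) × (R × R)) : cubeMul 1 0 (d₁ a) = d₁ (cubeT₁ a) := by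
  obtain ⟨u, v⟩ := a
  rw [cubeT₁_apply, cube_d₁]

theorem cubeT₂_d₂ (a : (R × R) × (R × R)) : cubeT₁ (d₂ a) = d₂ (cubeT₂ a) := by
  obtain ⟨r, s⟩ := a
  rw [← Prod.mk.eta (p := d₂ (r, s)), cubeT₁_apply, cubeT₂_apply, cube_d₂_fst, cube_d₂_snd]

theorem cubeT₃_d₃ (a : R × R) : cubeT₂ (d₃ a) = d₃ (cubeT₃ a) := by
  rw [← Prod.mk.eta (p := d₃ a), cubeT₂_apply, cube_d₃_fst, cube_d₃_snd, cubeT₃]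

theorem hasDegree_cube : extension.HasDegree cube.toMonoidHom 9 := by
  refine ⟨cubeMul 1 0, cubeT₁, cubeT₂, cubeT₃, cubeMul_rep _ _, cubeT₁_rep, cubeT₂_rep,
    cubeMul_rep _ _, fun a => ?_, cubeT₁_d₁, cubeT₂_d₂, cubeT₃_d₃, fun n => ?_⟩
  · change aug _ + aug _ = aug _ + aug _
    simp [cubeMul_apply]
  · have h (n : ℤ) : extension.ι n = n • ((normElt, normElt) : R × R) := rfl
    rw [h, h, map_zsmul, cubeT₃, cube_normElt, smul_smul, mul_comm n]

theorem cube_pow_hasDegree (e : ℕ) : extension.HasDegree (cube ^ e).toMonoidHom (9 ^ e) := by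
  induction e with
  | zero =>
    have := extension.hasDegree_conj 1
    rw [map_one] at this
    exact this
  | succ e ih => exact ih.comp hasDegree_cube

theorem sign_cube_pow (e : ℕ) (q : QuaternionGroup 4) : Q16.sign ((cube ^ e) q) = Q16.sign q := by
  have h (q : QuaternionGroup 4) : Q16.sign (cube q) = Q16.sign q := by revert q; decide
  induction e generalizing q with
  | zero => rfl
  | succ e ih => rw [pow_succ, MulAut.mul_apply, ih, h]

theorem hom_ext {f g : QuaternionGroup 4 →* QuaternionGroup 4} (ha : f (.a 1) = g (.a 1))
    (hx : f (.xa 0) = g (.xa 0)) : f = g := by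
  have h (i : ZMod (2 * 4)) : f (.a i) = g (.a i) := by
    have : (.a i : QuaternionGroup 4) = .a 1 ^ i.val := by
      rw [QuaternionGroup.a_one_pow, ZMod.natCast_zmod_val]
    rw [this, map_pow, map_pow, ha]
  refine MonoidHom.ext fun q => ?_
  rcases q with i | i
  · exact h i
  · have : (.xa i : QuaternionGroup 4) = .xa 0 * .a i := by simp
    rw [this, map_mul, map_mul, hx, h]

/-- The hypotheses force `u` to be an odd power of `x` and `v` to be `y` times an even one. On these
16 pairs the inner automorphism group, of order 8, acts freely, with orbit representatives `(x, y)`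
and `(x³, y)`. -/
theorem exists_conj_of_generators : ∀ u v : QuaternionGroup 4, Q16.sign u = -1 → Q16.sign v = 1 →
    u ^ 4 ≠ 1 → u * v ≠ v * u → ∃ q : QuaternionGroup 4,
      (q * .a 1 * q⁻¹ = u ∧ q * .xa 0 * q⁻¹ = v) ∨ (q * .a 3 * q⁻¹ = u ∧ q * .xa 0 * q⁻¹ = v) := by
  decide

theorem exists_eq_conj_cube {η : QuaternionGroup 4 →* QuaternionGroup 4}
    (hη : Function.Injective η) (hs : ∀ q, Q16.sign (η q) = Q16.sign q) :
    ∃ q e, η = (MulAut.conj q).toMonoidHom.comp (cube ^ e).toMonoidHom := by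
  obtain ⟨q, ⟨h₁, h₂⟩ | ⟨h₁, h₂⟩⟩ := exists_conj_of_generators (η (.a 1)) (η (.xa 0))
    (by rw [hs]; decide) (by rw [hs]; decide)
    (by rw [← map_pow, ← map_one η, hη.ne_iff]; decide)
    (by rw [← map_mul, ← map_mul, hη.ne_iff]; decide)
  · exact ⟨q, 0, hom_ext h₁.symm h₂.symm⟩
  · exact ⟨q, 1, hom_ext h₁.symm h₂.symm⟩

theorem exists_hasDegree {η : QuaternionGroup 4 →* QuaternionGroup 4}
    (hη : Function.Injective η) (hs : ∀ q, Q16.sign (η q) = Q16.sign q) :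
    ∃ e : ℕ, extension.HasDegree η (9 ^ e) := by
  obtain ⟨q, e, rfl⟩ := exists_eq_conj_cube hη hs
  have := (extension.hasDegree_conj q).comp (cube_pow_hasDegree e)
  rw [one_mul] at this
  exact ⟨e, this⟩

end Quat

/-! ### The 2-part and the automorphisms of `Q(16, p, 1)` -/

namespace Q16p

open CyclicRing

variable {p : ℕ}

/-- The extension of `Q₁₆` inflated to `Q(16, p, 1)`. -/
noncomputable abbrev quatExtension (p : ℕ) :=
  Quat.extension.inflate (SemidirectProduct.rightHom : Q16p p →* QuaternionGroup 4)

/-- `C_p` acts trivially, so every summand of the trace over `Q₁₆` is repeated `p` times. -/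
theorem traceEq_inflate [NeZero p] {M : Type} [AddCommGroup M]
    {ρ : Representation ℤ (QuaternionGroup 4) M} (hρ : TraceEq ρ 1) :
    TraceEq (ρ.comp (SemidirectProduct.rightHom : Q16p p →* QuaternionGroup 4)) p := by
  obtain ⟨h, hh⟩ := hρ
  refine ⟨h, fun a => ?_⟩
  have key (q : QuaternionGroup 4) (c : ZMod p) :
      ρ.comp (SemidirectProduct.rightHom : Q16p p →* QuaternionGroup 4) (⟨.ofAdd c, q⟩ : Q16p p)⁻¹
        (h (ρ.comp (SemidirectProduct.rightHom : Q16p p →* QuaternionGroup 4)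
          (⟨.ofAdd c, q⟩ : Q16p p) a)) = ρ q⁻¹ (h (ρ q a)) := rfl
  rw [sum_eq]
  simp only [key, Finset.sum_const, Finset.card_univ, ZMod.card, ← Finset.smul_sum, hh, one_smul,
    natCast_zsmul]

theorem exists_quat_class [NeZero p] (hp : Odd p) : ∃ κ : integralCohomology (Q16p p) 4,
    (∀ u, ∃ n : ℤ, (p : ℤ) ^ 4 • u = n • κ) ∧ (∀ n : ℤ, n • κ = 0 ↔ 16 ∣ n) ∧
      ∀ θ r, (quatExtension p).HasDegree θ r → r • cohomologyPullback θ 4 κ = κ := by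
  have h₁ := traceEq_inflate (p := p) Quat.traceEq_rep
  have h₂ := traceEq_inflate (p := p) (Quat.traceEq_rep.prod Quat.traceEq_rep)
  refine (quatExtension p).exists_characteristic_class ?_ h₁ h₂ h₂ h₁
    ⟨(normElt, normElt), fun g => ?_, ?_⟩ fun a ha => ?_
  · have : Nat.Coprime p (2 ^ 4) := hp.coprime_two_right.pow_right 4
    exact_mod_cast Nat.isCoprime_iff_coprime.2 this
  · have := Quat.extension.ι_equivariant g.right 1
    have h : Quat.extension.ι 1 = (normElt, normElt) := one_smul ℤ _
    rw [h] at this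
    exact this.symm
  · change aug normElt + aug normElt = 16
    rw [aug_normElt]
    rfl
  · have h (q : QuaternionGroup 4) : Quat.rep q a = a := ha (SemidirectProduct.inr q)
    have hX := h (.a 1)
    have hY := h (.xa 0)
    rw [Quat.rep_a] at hX
    rw [Quat.rep_xa] at hY
    obtain ⟨b, hb⟩ := exists_of_mul_eq_zero (f := a.1) (by
      rw [sub_one_mul, sub_eq_zero]; exact congrArg Prod.fst hX)
    -- Invariance under `x` makes `a.1` a multiple of the norm of order 8, and invariance under `y`
    -- equates the two augmentations, so the total is a multiple of `2·8`.
    have hab : aug a.2 = aug a.1 := by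
      have := congrArg (fun z : Quat.R × Quat.R => aug z.1) hY
      simpa using this
    change 16 ∣ aug a.1 + aug a.2
    rw [hab, hb, map_zsmul, aug_normElt]
    exact ⟨b, by push_cast; rw [smul_eq_mul]; ring⟩

theorem shift_mul_of_sgn (g h : Q16p p) (hg : sgn g = 1) : shift (g * h) = shift g + shift h := by
  rw [shift_mul, hg, Units.val_one, Int.cast_one, one_mul]

/-- The element `z ^ c` of the normal subgroup `C_p`. -/
abbrev rotation (c : ZMod p) : Q16p p := SemidirectProduct.inl (.ofAdd c)

/-- The element `q` of the complement `Q₁₆`. -/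
abbrev lift (q : QuaternionGroup 4) : Q16p p := SemidirectProduct.inr q

theorem eq_rotation_mul_lift (g : Q16p p) : g = rotation (shift g) * lift g.right :=
  (SemidirectProduct.inl_left_mul_inr_right g).symm

theorem rotation_add (c c' : ZMod p) : rotation (c + c') = rotation c * rotation c' :=
  map_mul SemidirectProduct.inl (Multiplicative.ofAdd c) (Multiplicative.ofAdd c')

theorem ext_shift {g h : Q16p p} (h₁ : shift g = shift h) (h₂ : g.right = h.right) : g = h :=
  SemidirectProduct.ext h₁ h₂

theorem lift_mul_rotation (q : QuaternionGroup 4) (c : ZMod p) :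
    lift q * rotation c = rotation (((Q16.sign q : ℤ) : ZMod p) * c) * lift q := by
  refine ext_shift ?_ ?_
  · have h : sgn (rotation (((Q16.sign q : ℤ) : ZMod p) * c)) = 1 := map_one Q16.sign
    rw [shift_mul, shift_mul_of_sgn _ _ h]
    exact (zero_add _).trans (add_zero _).symm
  · exact (mul_one q).trans (one_mul q).symm

theorem sign_unit_injective [NeZero p] (hp : Odd p) (hp1 : p ≠ 1) {u v : ℤˣ}
    (h : ((u : ℤ) : ZMod p) = ((v : ℤ) : ZMod p)) : u = v := by
  have h2 : (2 : ZMod p) ≠ 0 := by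
    intro h0
    have : ((2 : ℕ) : ZMod p) = 0 := by exact_mod_cast h0
    rw [ZMod.natCast_eq_zero_iff] at this
    rcases (Nat.dvd_prime Nat.prime_two).1 this with h | h
    · exact hp1 h
    · subst h; exact absurd hp (by decide)
  rcases Int.units_eq_one_or u with rfl | rfl <;> rcases Int.units_eq_one_or v with rfl | rfl <;>
    simp at h ⊢
  · exact h2 (by linear_combination h)
  · exact h2 (by linear_combination -h)

/-- `C_p` is characteristic: an element of `Q₁₆` whose order divides both `p` and 16 is trivial. -/
theorem right_map_rotation (hp : Odd p) (θ : MulAut (Q16p p)) (c : ZMod p) :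
    (θ (rotation c)).right = 1 := by
  have h₁ : (θ (rotation c)).right ^ p = 1 := by
    have : (rotation c : Q16p p) ^ p = 1 := by
      rw [← map_pow, ← ofAdd_nsmul, nsmul_eq_mul, CharP.cast_eq_zero, zero_mul, ofAdd_zero, map_one]
    have h := congrArg (SemidirectProduct.rightHom.comp θ.toMonoidHom) this
    rwa [map_pow, map_one] at h
  have h₂ : (θ (rotation c)).right ^ 16 = 1 := by
    have := pow_card_eq_one (x := (θ (rotation c)).right)
    rwa [QuaternionGroup.card] at this
  have h16 : Nat.Coprime p (2 ^ 4) := hp.coprime_two_right.pow_right 4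
  rw [← orderOf_eq_one_iff]
  exact Nat.eq_one_of_dvd_coprimes h16 (orderOf_dvd_of_pow_eq_one h₁) (orderOf_dvd_of_pow_eq_one h₂)

/-- The endomorphism of `Q₁₆` induced by an automorphism. -/
def quotientHom (θ : MulAut (Q16p p)) : QuaternionGroup 4 →* QuaternionGroup 4 :=
  SemidirectProduct.rightHom.comp (θ.toMonoidHom.comp SemidirectProduct.inr)

theorem right_map (hp : Odd p) (θ : MulAut (Q16p p)) (g : Q16p p) :
    (θ g).right = quotientHom θ g.right := by
  conv_lhs => rw [eq_rotation_mul_lift g, map_mul, SemidirectProduct.mul_right,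
    right_map_rotation hp, one_mul]
  rfl

theorem quotientHom_injective (hp : Odd p) (θ : MulAut (Q16p p)) :
    Function.Injective (quotientHom θ) := by
  rw [Finite.injective_iff_surjective]
  intro q
  refine ⟨(θ.symm (lift q)).right, ?_⟩
  rw [← right_map hp, MulEquiv.apply_symm_apply]
  rfl

theorem shift_map_rotation (hp : Odd p) (θ : MulAut (Q16p p)) (c : ZMod p) :
    shift (θ (rotation c)) = shift (θ (rotation 1)) * c := by
  have hs (c : ZMod p) : sgn (θ (rotation c)) = 1 := by
    rw [sgn, right_map_rotation hp, map_one]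
  let f : ZMod p →+ ZMod p :=
    { toFun c := shift (θ (rotation c))
      map_zero' := by
        change shift (θ 1) = 0
        rw [map_one, shift_one]
      map_add' c c' := by rw [rotation_add, map_mul, shift_mul_of_sgn _ _ (hs c)] }
  change f c = f 1 * c
  obtain ⟨n, rfl⟩ := ZMod.intCast_surjective c
  rw [← zsmul_one, map_zsmul, zsmul_eq_mul, zsmul_one, mul_comm]

theorem shift_map (hp : Odd p) (θ : MulAut (Q16p p)) (g : Q16p p) :
    shift (θ g) = shift (θ (rotation 1)) * shift g + shift (θ (lift g.right)) := by
  conv_lhs => rw [eq_rotation_mul_lift g, map_mul]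
  rw [shift_mul_of_sgn, shift_map_rotation hp]
  rw [sgn, right_map_rotation hp, map_one]

theorem shift_map_rotation_one_ne_zero (hp : Odd p) (hp1 : p ≠ 1) (θ : MulAut (Q16p p)) :
    shift (θ (rotation 1)) ≠ 0 := by
  intro h
  have : θ (rotation 1) = 1 := ext_shift h (right_map_rotation hp θ 1)
  rw [map_eq_one_iff θ θ.injective] at this
  have h1 : (1 : ZMod p) = 0 := congrArg shift this
  have := (ZMod.subsingleton_iff (n := p)).1 (subsingleton_of_zero_eq_one h1.symm)
  exact hp1 this

variable [Fact p.Prime]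

/-- The sign is the character by which `G` acts on the characteristic subgroup `C_p`, whose
automorphism group is abelian. Concretely, `θ` is applied to `q z = z^(±1) q` and the exponents of
`z` are compared; `1 ≠ -1` mod `p`. -/
theorem sgn_map (hp : Odd p) (θ : MulAut (Q16p p)) (g : Q16p p) : sgn (θ g) = sgn g := by
  have hp1 : p ≠ 1 := (Fact.out : p.Prime).ne_one
  have key (q : QuaternionGroup 4) : sgn (θ (lift q)) = Q16.sign q := by
    have h := congrArg (fun g => shift (θ g)) (lift_mul_rotation q (1 : ZMod p))
    rw [map_mul, map_mul, shift_mul, shift_mul_of_sgn, shift_map_rotation hp θ (_ * 1)] at h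
    · refine sign_unit_injective hp hp1 (mul_right_cancel₀ (shift_map_rotation_one_ne_zero hp hp1 θ) ?_)
      linear_combination h
    · rw [sgn, right_map_rotation hp, map_one]
  have := key g.right
  rw [sgn, right_map hp] at this ⊢
  exact this

/-- `q ↦ shift (θ (lift q))` is a 1-cocycle of `Q₁₆` in the sign-twisted `ℤ/p`. As 16 is invertible
mod `p`, it is the coboundary of its average. -/
theorem exists_shift_map_lift (hp : Odd p) (θ : MulAut (Q16p p)) : ∃ W : ZMod p,
    ∀ q, shift (θ (lift q)) = W - ((Q16.sign q : ℤ) : ZMod p) * W := by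
  have h16 : (16 : ZMod p) ≠ 0 := by
    have h : ¬ p ∣ 2 ^ 4 := fun h => by
      have := (Nat.prime_dvd_prime_iff_eq Fact.out Nat.prime_two).1
        ((Fact.out : p.Prime).dvd_of_dvd_pow h)
      subst this
      exact absurd hp (by decide)
    rw [← ZMod.natCast_eq_zero_iff] at h
    intro h'
    exact h (by exact_mod_cast h')
  have hmul (q q' : QuaternionGroup 4) : shift (θ (lift (q * q'))) =
      shift (θ (lift q)) + ((Q16.sign q : ℤ) : ZMod p) * shift (θ (lift q')) := by
    have : (lift (q * q') : Q16p p) = lift q * lift q' := map_mul SemidirectProduct.inr q q'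
    rw [this, map_mul, shift_mul, sgn_map hp]
    rfl
  refine ⟨(16 : ZMod p)⁻¹ * ∑ q, shift (θ (lift q)), fun q => mul_left_cancel₀ h16 ?_⟩
  have hsum : ∑ q', shift (θ (lift (q * q'))) = ∑ q', shift (θ (lift q')) :=
    Equiv.sum_comp (Equiv.mulLeft q) fun q' => shift (θ (lift q'))
  simp only [hmul, Finset.sum_add_distrib, Finset.sum_const, Finset.card_univ,
    QuaternionGroup.card, ← Finset.mul_sum, nsmul_eq_mul] at hsum
  push_cast at hsum
  have h := mul_inv_cancel₀ h16
  linear_combination hsum - (1 - ((Q16.sign q : ℤ) : ZMod p)) * (∑ q, shift (θ (lift q))) * h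

theorem exists_degrees (hp : Odd p) (θ : MulAut (Q16p p)) : ∃ k e : ℕ,
    (cyclicExtension hp).HasDegree θ.toMonoidHom (k ^ 2) ∧
      (quatExtension p).HasDegree θ.toMonoidHom (9 ^ e) := by
  have hp1 : p ≠ 1 := (Fact.out : p.Prime).ne_one
  have ha := shift_map_rotation_one_ne_zero hp hp1 θ
  obtain ⟨W, hW⟩ := exists_shift_map_lift hp θ
  obtain ⟨e, he⟩ := Quat.exists_hasDegree (quotientHom_injective hp θ) fun q =>
    sgn_map hp θ (lift q)
  refine ⟨(shift (θ (rotation 1)))⁻¹.val, e, cyclicExtension_hasDegree hp (W := W)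
    (a := shift (θ (rotation 1))) ?_ (fun g => ?_) (sgn_map hp θ),
    he.inflate _ (right_map hp θ)⟩
  · rw [ZMod.natCast_zmod_val, inv_mul_cancel₀ ha]
  · have h := shift_map hp θ g
    rw [hW, ← add_sub_assoc] at h
    exact h

theorem exists_mulAut (hp : Odd p) {a : ZMod p} {k : ℕ} (hk : (k : ZMod p) * a = 1) (e : ℕ) :
    ∃ θ : MulAut (Q16p p), (cyclicExtension hp).HasDegree θ.toMonoidHom (k ^ 2) ∧
      (quatExtension p).HasDegree θ.toMonoidHom (9 ^ e) := by
  let u : (ZMod p)ˣ := Units.mkOfMulEqOne a k (by rw [mul_comm, hk])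
  let fn : Multiplicative (ZMod p) ≃* Multiplicative (ZMod p) :=
    AddEquiv.toMultiplicative (AddAut.mulLeft u)
  let θ : MulAut (Q16p p) := SemidirectProduct.congr fn (Quat.cube ^ e) fun q => by
    refine MulEquiv.ext fun z => ?_
    change fn (z ^ (Q16.sign q : ℤ)) = fn z ^ (Q16.sign ((Quat.cube ^ e) q) : ℤ)
    rw [map_zpow, Quat.sign_cube_pow]
  refine ⟨θ, cyclicExtension_hasDegree hp (W := 0) hk (fun g => ?_) (fun g => ?_),
    (Quat.cube_pow_hasDegree e).inflate _ fun g => rfl⟩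
  · rw [mul_zero, sub_zero, add_zero]
    rfl
  · exact Quat.sign_cube_pow e g.right

end Q16p

/-! ### From degrees to the image of `ψ₄` -/

theorem psi_apply {G : Type} [Group G] {k n : ℕ} (e : integralCohomology G k ≃+ ZMod n)
    (θ : MulAut G) (c : integralCohomology G k) :
    e (cohomologyPullback θ.toMonoidHom k c) = psi e θ * e c := by
  let f : AddAut (ZMod n) := (e.symm.trans (cohomologyAut k θ).toAddEquiv).trans e
  have hf : f (e c) = e (cohomologyPullback θ.toMonoidHom k c) := by
    change e (cohomologyPullback θ.toMonoidHom k (e.symm (e c))) = _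
    rw [AddEquiv.symm_apply_apply]
  have h (x : ZMod n) : f 1 * x = f x := by
    rw [mul_comm, ← x.intCast_zmod_cast, ← zsmul_eq_mul, ← map_zsmul, zsmul_one]
  rw [← hf, ← h]
  rfl

theorem mul_sub_one_zsmul_eq_zero {A : Type*} [AddCommGroup A] {x y : A} {r u : ℤ}
    (h : y = u • x) (hr : r • y = x) : (r * u - 1) • x = 0 := by
  rw [sub_smul, one_smul, mul_smul, ← h, hr, sub_self]

/-- If the integer `u` represents `ψ(θ)`, then `θ^*κ = uκ`. Hence `(ru - 1)κ = 0`, and `d` divides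
`ru - 1`. -/
theorem castHom_psi_eq_one {G : Type} [Group G] {k n d : ℕ} [NeZero n]
    (e : integralCohomology G k ≃+ ZMod n) (hd : d ∣ n) {θ : MulAut G} {r : ℤ}
    {κ : integralCohomology G k} (hκ : ∀ m : ℤ, m • κ = 0 → (d : ℤ) ∣ m)
    (hr : r • cohomologyPullback θ.toMonoidHom k κ = κ) :
    (r : ZMod d) * ZMod.castHom hd (ZMod d) (psi e θ) = 1 := by
  obtain ⟨u, hu⟩ := ZMod.intCast_surjective (psi e θ : ZMod n)
  have h : cohomologyPullback θ.toMonoidHom k κ = u • κ := e.injective (by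
    rw [psi_apply, map_zsmul, ← hu, zsmul_eq_mul])
  have := hκ _ (mul_sub_one_zsmul_eq_zero h hr)
  rw [← ZMod.intCast_zmod_eq_zero_iff_dvd] at this
  rw [← hu, map_intCast]
  push_cast at this
  exact sub_eq_zero.1 this

/-- Since `s` and `t` are coprime, `a` and `b` generate `A`. Their orders `m` and `n` are coprime,
so `a + b` generates too and has order `mn`. -/
theorem nonempty_addEquiv_zmod {A : Type*} [AddCommGroup A] {m n : ℕ} (hmn : m.Coprime n)
    {a b : A} {s t : ℤ} (hst : IsCoprime s t) (ha : ∀ u : A, ∃ k : ℤ, s • u = k • a)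
    (hb : ∀ u : A, ∃ k : ℤ, t • u = k • b) (ha' : ∀ k : ℤ, k • a = 0 ↔ (m : ℤ) ∣ k)
    (hb' : ∀ k : ℤ, k • b = 0 ↔ (n : ℤ) ∣ k) : Nonempty (A ≃+ ZMod (m * n)) := by
  have hmn' : IsCoprime (m : ℤ) n := Nat.isCoprime_iff_coprime.2 hmn
  have hma : (m : ℤ) • a = 0 := (ha' _).2 dvd_rfl
  have hnb : (n : ℤ) • b = 0 := (hb' _).2 dvd_rfl
  have hzero (k : ℤ) (hk : k • (a + b) = 0) : ((m * n : ℕ) : ℤ) ∣ k := by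
    push_cast
    refine hmn'.mul_dvd (hmn'.dvd_of_dvd_mul_left ((ha' _).1 (?_ : (n * k : ℤ) • a = 0)))
      (hmn'.symm.dvd_of_dvd_mul_left ((hb' _).1 (?_ : (m * k : ℤ) • b = 0)))
    · have h := congrArg ((n : ℤ) • ·) hk
      simp only [smul_add, smul_zero, smul_smul] at h
      rw [mul_comm (n : ℤ) k, mul_smul k _ b, hnb, smul_zero, add_zero] at h
      rwa [mul_comm]
    · have h := congrArg ((m : ℤ) • ·) hk
      simp only [smul_add, smul_zero, smul_smul] at h
      rw [mul_comm (m : ℤ) k, mul_smul k _ a, hma, smul_zero, zero_add] at h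
      rwa [mul_comm]
  have hsurj (u : A) : ∃ k : ℤ, k • (a + b) = u := by
    obtain ⟨x, y, hxy⟩ := hst
    obtain ⟨z, w, hzw⟩ := hmn'
    obtain ⟨k, hk⟩ := ha u
    obtain ⟨l, hl⟩ := hb u
    refine ⟨x * k * (w * n) + y * l * (z * m), ?_⟩
    have h₁ : (w * n : ℤ) • a = a := by
      have : (w * n : ℤ) = 1 - z * m := by linear_combination hzw
      rw [this, sub_smul, one_smul, mul_smul, hma, smul_zero, sub_zero]
    have h₂ : (z * m : ℤ) • b = b := by
      have : (z * m : ℤ) = 1 - w * n := by linear_combination hzw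
      rw [this, sub_smul, one_smul, mul_smul, hnb, smul_zero, sub_zero]
    have h₃ : (w * n : ℤ) • b = 0 := by rw [mul_smul, hnb, smul_zero]
    have h₄ : (z * m : ℤ) • a = 0 := by rw [mul_smul, hma, smul_zero]
    have e₁ : (x * k * (w * n)) • (a + b) = (x * k) • a := by
      rw [mul_smul, smul_add, h₁, h₃, add_zero]
    have e₂ : (y * l * (z * m)) • (a + b) = (y * l) • b := by
      rw [mul_smul, smul_add, h₂, h₄, zero_add]
    rw [add_smul, e₁, e₂, mul_smul, mul_smul, ← hk, ← hl, smul_smul, smul_smul, ← add_smul, hxy, one_smul]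
  let f : { f : ℤ →+ A // f ((m * n : ℕ) : ℤ) = 0 } := ⟨zmultiplesHom A (a + b), by
    rw [zmultiplesHom_apply, smul_add, Nat.cast_mul, mul_smul _ _ b, hnb, mul_comm, mul_smul, hma,
      smul_zero, smul_zero, add_zero]⟩
  refine ⟨(AddEquiv.ofBijective (ZMod.lift (m * n) f) ⟨(ZMod.lift_injective (m * n)).2 fun k hk => ?_,
    fun u => ?_⟩).symm⟩
  · exact (ZMod.intCast_zmod_eq_zero_iff_dvd _ _).2 (hzero k hk)
  · obtain ⟨k, hk⟩ := hsurj u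
    exact ⟨k, (ZMod.lift_coe (m * n) _ _).trans hk⟩

theorem zmod_mul_ext {m n : ℕ} (h : m.Coprime n) {x y : ZMod (m * n)}
    (h₁ : ZMod.castHom (dvd_mul_right m n) (ZMod m) x = ZMod.castHom (dvd_mul_right m n) (ZMod m) y)
    (h₂ : ZMod.castHom (dvd_mul_left n m) (ZMod n) x = ZMod.castHom (dvd_mul_left n m) (ZMod n) y) :
    x = y := by
  obtain ⟨x, rfl⟩ := ZMod.intCast_surjective x
  obtain ⟨y, rfl⟩ := ZMod.intCast_surjective y
  rw [map_intCast, map_intCast, ZMod.intCast_eq_intCast_iff_dvd_sub] at h₁ h₂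
  rw [ZMod.intCast_eq_intCast_iff_dvd_sub]
  push_cast
  exact (Nat.isCoprime_iff_coprime.2 h).mul_dvd h₁ h₂

theorem exists_zmod_mul {m n : ℕ} (h : m.Coprime n) (a b : ℕ) :
    ∃ c : ℕ, (c : ZMod m) = a ∧ (c : ZMod n) = b := by
  obtain ⟨c, h₁, h₂⟩ := Nat.chineseRemainder h a b
  exact ⟨c, (ZMod.natCast_eq_natCast_iff _ _ _).2 h₁, (ZMod.natCast_eq_natCast_iff _ _ _).2 h₂⟩

theorem mainTheorem7 (p : ℕ) (hp : p.Prime) (hp2 : p ≠ 2) :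
    Nat.card (Q16p p) = 16 * p ∧
    Nonempty (integralCohomology (Q16p p) 4 ≃+ ZMod (16 * p)) ∧
    ∀ e : integralCohomology (Q16p p) 4 ≃+ ZMod (16 * p),
      (psi e).range = (powMonoidHom 2 : (ZMod (16 * p))ˣ →* (ZMod (16 * p))ˣ).range := by
  have : Fact p.Prime := ⟨hp⟩
  have hodd : Odd p := hp.odd_of_ne_two hp2
  have hcop : Nat.Coprime 16 p := (hodd.coprime_two_left).pow_left 4
  have hcop' : IsCoprime (p : ℤ) 16 := by exact_mod_cast Nat.isCoprime_iff_coprime.2 hcop.symm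
  obtain ⟨κ₂, h₂, h₂', hd₂⟩ := Q16p.exists_quat_class hodd
  obtain ⟨κₚ, hₚ, hₚ', hdₚ⟩ := Q16p.exists_cyclic_class hodd
  have hne : NeZero (16 * p) := ⟨mul_ne_zero (by decide) hp.ne_zero⟩
  refine ⟨?_, nonempty_addEquiv_zmod hcop (hcop'.pow (m := 4) (n := 4)) h₂ hₚ h₂' hₚ', fun e => ?_⟩
  · rw [SemidirectProduct.card, Nat.card_congr Multiplicative.toAdd, Nat.card_zmod,
      Nat.card_eq_fintype_card, QuaternionGroup.card, mul_comm]
  let π₂ := ZMod.castHom (dvd_mul_right 16 p) (ZMod 16)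
  let πₚ := ZMod.castHom (dvd_mul_left p 16) (ZMod p)
  have hψ {θ : MulAut (Q16p p)} {k f : ℕ}
      (hk : (Q16p.cyclicExtension hodd).HasDegree θ.toMonoidHom (k ^ 2))
      (hf : (Q16p.quatExtension p).HasDegree θ.toMonoidHom (9 ^ f)) :
      9 ^ f * π₂ (psi e θ) = 1 ∧ (k : ZMod p) ^ 2 * πₚ (psi e θ) = 1 := by
    constructor
    · have := castHom_psi_eq_one e (dvd_mul_right 16 p) (fun m hm => (h₂' m).1 hm) (hd₂ _ _ hf)
      exact_mod_cast this
    · have := castHom_psi_eq_one e (dvd_mul_left p 16) (fun m hm => (hₚ' m).1 hm) (hdₚ _ _ hk)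
      exact_mod_cast this
  ext u
  constructor
  · rintro ⟨θ, rfl⟩
    obtain ⟨k, f, hk, hf⟩ := Q16p.exists_degrees hodd θ
    obtain ⟨h₁, h₂⟩ := hψ hk hf
    -- The degrees `9^f` and `k²` are squares of `3^f` and `k`; gluing these gives a square root of
    -- `ψ(θ)⁻¹`.
    obtain ⟨c, hc₁, hc₂⟩ := exists_zmod_mul hcop (3 ^ f) k
    have hc : (c : ZMod (16 * p)) ^ 2 * psi e θ = 1 := by
      refine zmod_mul_ext hcop ?_ ?_
      · have h9 : ((3 ^ f : ℕ) : ZMod 16) ^ 2 = 9 ^ f := by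
          push_cast
          rw [← pow_mul, mul_comm f 2, pow_mul]
          norm_num
        rw [map_mul, map_pow, map_natCast, hc₁, map_one, h9]
        exact h₁
      · rw [map_mul, map_pow, map_natCast, hc₂, map_one]
        exact h₂
    let w : (ZMod (16 * p))ˣ := Units.mkOfMulEqOne c (c * psi e θ) (by rw [← mul_assoc, ← sq, hc])
    refine ⟨w⁻¹, ?_⟩
    rw [powMonoidHom_apply, inv_pow, inv_eq_iff_mul_eq_one]
    exact Units.ext hc
  · rintro ⟨s, rfl⟩
    let t : ZMod (16 * p) := (s⁻¹ : (ZMod (16 * p))ˣ)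
    have hs : πₚ t * πₚ s = 1 := by rw [← map_mul, Units.inv_mul, map_one]
    have hs₂ : ∃ f : ℕ, π₂ s ^ 2 = 9 ^ f := by
      have h : π₂ s * π₂ t = 1 := by rw [← map_mul, Units.mul_inv, map_one]
      have key : ∀ x y : ZMod 16, x * y = 1 → x ^ 2 = 9 ^ 0 ∨ x ^ 2 = 9 ^ 1 := by decide
      rcases key _ _ h with h | h
      · exact ⟨0, h⟩
      · exact ⟨1, h⟩
    obtain ⟨f, hf⟩ := hs₂
    -- Raising `z` to the power `s` mod `p` gives degree `s⁻²`, hence `ψ(θ) = s²` mod `p`.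
    obtain ⟨θ, hk, hf'⟩ := Q16p.exists_mulAut hodd (a := πₚ s) (k := (πₚ t).val)
      (by rw [ZMod.natCast_zmod_val, hs]) f
    obtain ⟨h₁, h₂⟩ := hψ hk hf'
    rw [ZMod.natCast_zmod_val] at h₂
    refine ⟨θ, Units.ext (zmod_mul_ext hcop ?_ ?_)⟩
    · rw [powMonoidHom_apply, Units.val_pow_eq_pow_val, map_pow]
      change π₂ _ = π₂ s ^ 2
      -- `9` is its own inverse mod 16, so degree `9^f` gives `ψ(θ) = 9^f = s²` there.
      have h81 : (9 ^ f * 9 ^ f : ZMod 16) = 1 := by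
        rw [← mul_pow]
        have : (9 * 9 : ZMod 16) = 1 := by decide
        rw [this, one_pow]
      rw [hf]
      linear_combination 9 ^ f * h₁ - π₂ (psi e θ) * h81
    · rw [powMonoidHom_apply, Units.val_pow_eq_pow_val, map_pow]
      change πₚ _ = πₚ s ^ 2
      linear_combination πₚ s ^ 2 * h₂ -
        (πₚ t * πₚ s + 1) * πₚ (psi e θ) * hs
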